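/- Let $\mathfrak o$ be a complete discrete valuation ring with finite residue field of characteristic two, maximal ideal $\wp$ and uniformizer $\pi$, and put $\mathfrak o_n=\mathfrak o/\wp^n$. Let $\mathbf R_{\mathfrak o}=4e$ if $\mathfrak o$ has characteristic $0$ and ramification index $e$ (that is, $2\mathfrak o=\wp^e$), and $\mathbf R_{\mathfrak o}=2$ if $\mathfrak o$ has characteristic $2$. Let $\ell$ be such that $r=2\ell\ge\mathbf R_{\mathfrak o}$, and let $\psi:\mathfrak o_{2\ell}\to\mathbb C^\times$ be an additive character with $\psi(\pi^{2\ell-1})\ne 1$. Let $M^\ell=\ker(\mathrm{GL}_2(\mathfrak o_{2\ell})\to\mathrm{GL}_2(\mathfrak o_\ell))$ and $K^\ell=M^\ell\cap\mathrm{SL}_2(\mathfrak o_{2\ell})$. For $A\in M_2(\mathfrak o_\ell)$ with a lift $\hat A\in M_2(\mathfrak o_{2\ell})$, let $\psi_A$ be the (well-defined) one-dimensional representation $\psi_A(I+\pi^\ell B)=\psi(\pi^\ell\,\mathrm{tr}(\hat AB))$ of $M^\ell$, and let $\psi_{[A]}=\psi_A|_{K^\ell}$. Write $C_S(\psi_A)$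 and $C_S(\psi_{[A]})$ for the stabilizers of $\psi_A$ and $\psi_{[A]}$ in $S=\mathrm{SL}_2(\mathfrak o_{2\ell})$ acting by conjugation. For $K^\ell\le H\le S$ let $\mathrm{Irr}(H\mid\psi_{[A]})$ be the set of isomorphism classes of irreducible complex representations of $H$ that are constituents of $\mathrm{Ind}_{K^\ell}^H\psi_{[A]}$. The matrix $A$ is called cyclic if there is a vector $v\in\mathfrak o_\ell^2$ such that $\{v,Av\}$ generates $\mathfrak o_\ell^2$. Then for every cyclic $A\in M_2(\mathfrak o_\ell)$ there exists a unique normal subgroup $\mathbb M_A$ of $C_S(\psi_{[A]})$ such that $C_S(\psi_A)\subseteq\mathbb M_A$ and the following hold. 1. The character $\psi_{[A]}$ of $K^\ell$ extends to a one-dimensional representation of $\mathbb M_A$. 2. For every $\rho\in\mathrm{Irr}(\mathbb M_A\mid\psi_{[A]})$ the induced representation $\mathrm{Ind}_{\mathbb M_A}^{S}(\rho)$ is irreducible. 3. For every $\delta\in\mathrm{Irr}(S\mid\psi_{[A]})$ there exists $\rho\in\mathrm{Irr}(\mathbb M_A\mid\psi_{[A]})$ with $\delta\cong\mathrm{Ind}_{\mathbb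 M_A}^{S}(\rho)$. 4. The group $\mathbb M_A/K^\ell$ is either abelian or a semidirect product $B\rtimes D$ of an abelian normal subgroup $B$ with a group $D$ of order two. 5. Every $\rho\in\mathrm{Irr}(\mathbb M_A\mid\psi_{[A]})$ has dimension one or two. 6. The set of equivalence classes of $\mathrm{Irr}(\mathbb M_A\mid\psi_{[A]})$ under the conjugation action of $C_S(\psi_{[A]})$ is in bijective correspondence with $\mathrm{Irr}(S\mid\psi_{[A]})$. Moreover, the correspondence in (6) is realized by induction: $\rho\mapsto\mathrm{Ind}_{\mathbb M_A}^{S}(\rho)$ induces a bijection between these two sets. -/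

import Mathlib

open IsLocalRing

noncomputable section

section CliffordTheory

variable {G : Type*} [Group G]

/-- The inertia group (stabilizer) `C_G(χ) = {g ∈ G | χ^g = χ}` of a one-dimensional
representation `χ` of a normal subgroup `N` of `G`, where `χ^g(n) = χ(g n g⁻¹)`. -/
def inertiaGroup {N : Subgroup G} [N.Normal] (χ : N →* ℂˣ) : Subgroup G where
  carrier := {g | ∀ n : N, χ (MulAut.conjNormal g n) = χ n}
  one_mem' := by intro n; simp
  mul_mem' := by
    intro g h hg hh n
    rw [map_mul, MulAut.mul_apply]
    exact (hg _).trans (hh n)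
  inv_mem' := by
    intro g hg n
    have h := hg (MulAut.conjNormal g⁻¹ n)
    rw [← MulAut.mul_apply, ← map_mul, mul_inv_cancel, map_one, MulAut.one_apply] at h
    exact h.symm

/-- The one-dimensional complex representation (on `ℂ`) attached to a linear character. -/
def charRep {H : Type*} [Group H] (χ : H →* ℂˣ) : Representation ℂ H ℂ :=
  (Algebra.lmul ℂ ℂ : ℂ →* Module.End ℂ ℂ).comp ((Units.coeHom ℂ).comp χ)

/-- `Irr(H | χ)` before passing to isomorphism classes, for a linear character `χ` of a subgroup
`K` of `G` and a group `H` with a homomorphism `f : H → G` (in use, `f` is the inclusion of a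
subgroup `H` containing `K`, so that `K.comap f` is just `K` seen as a subgroup of `H`):
the irreducible complex representations of `H` that are constituents of the representation induced
from `χ`, i.e. are isomorphic to a subrepresentation of it.  The groups in use are finite, hence
every irreducible representation has a model on a vector space in `Type`. -/
structure IrrOver {K : Subgroup G} (χ : K →* ℂˣ) {H : Type*} [Group H] (f : H →* G) where
  /-- the representation -/
  rep : Rep.{0} ℂ H
  irreducible : rep.ρ.IsIrreducible
  constituent : ∃ T : rep.ρ.IntertwiningMap
    (Representation.ind (K.comap f).subtype (charRep (χ.comp (f.subgroupComap K)))),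
    Function.Injective T

/-- Isomorphism of representations, on `Irr(H | χ)`. -/
def isoSetoid {K : Subgroup G} (χ : K →* ℂˣ) {H : Type*} [Group H] (f : H →* G) :
    Setoid (IrrOver χ f) where
  r ρ₁ ρ₂ := Nonempty (ρ₁.rep.ρ.Equiv ρ₂.rep.ρ)
  iseqv :=
    { refl := fun _ => ⟨.refl _⟩
      symm := fun ⟨e⟩ => ⟨e.symm⟩
      trans := fun ⟨e⟩ ⟨e'⟩ => ⟨e.trans e'⟩ }

variable {K : Subgroup G} [K.Normal]

/-- The inclusion into `G` of a subgroup `M` of the inertia group of `χ`. -/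
abbrev inclG {χ : K →* ℂˣ} (M : Subgroup (inertiaGroup χ)) : M →* G :=
  (inertiaGroup χ).subtype.comp M.subtype

/-- `ρ₁` is isomorphic to the conjugate `ρ₂^g`, `ρ₂^g(m) = ρ₂(g m g⁻¹)`, for some `g ∈ S`, where
`ρ₁` and `ρ₂` are representations of a normal subgroup `M` of `S`. -/
def IsConjRep {S : Type*} [Group S] {M : Subgroup S} [M.Normal] {V W : Type*} [AddCommGroup V]
    [Module ℂ V] [AddCommGroup W] [Module ℂ W] (ρ₁ : Representation ℂ M V)
    (ρ₂ : Representation ℂ M W) : Prop :=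
  ∃ (g : S) (T : V ≃ₗ[ℂ] W), ∀ (m : M) (v : V), T (ρ₁ m v) = ρ₂ (MulAut.conjNormal g m) (T v)

section

variable {S : Type*} [Group S] {M : Subgroup S} [M.Normal] {V W U : Type*}
  [AddCommGroup V] [Module ℂ V] [AddCommGroup W] [Module ℂ W] [AddCommGroup U] [Module ℂ U]
  {ρ₁ : Representation ℂ M V} {ρ₂ : Representation ℂ M W} {ρ₃ : Representation ℂ M U}

theorem IsConjRep.rfl' : IsConjRep ρ₁ ρ₁ :=
  ⟨1, .refl ℂ V, fun m v => by rw [map_one, MulAut.one_apply]; rfl⟩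

theorem IsConjRep.symm' (h : IsConjRep ρ₁ ρ₂) : IsConjRep ρ₂ ρ₁ := by
  obtain ⟨g, T, hT⟩ := h
  refine ⟨g⁻¹, T.symm, fun m v => ?_⟩
  rw [LinearEquiv.symm_apply_eq, hT, ← MulAut.mul_apply, ← map_mul, mul_inv_cancel,
    map_one, MulAut.one_apply, LinearEquiv.apply_symm_apply]

theorem IsConjRep.trans' (h : IsConjRep ρ₁ ρ₂) (h' : IsConjRep ρ₂ ρ₃) : IsConjRep ρ₁ ρ₃ := by
  obtain ⟨g, T, hT⟩ := h
  obtain ⟨g', T', hT'⟩ := h'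
  refine ⟨g' * g, T.trans T', fun m v => ?_⟩
  rw [LinearEquiv.trans_apply, hT, hT', map_mul, MulAut.mul_apply, LinearEquiv.trans_apply]

end

/-- Equivalence under the conjugation action of the inertia group `C_G(χ)` on (isomorphism classes
in) `Irr(M | χ)`, for `M` a normal subgroup of `C_G(χ)`. -/
def conjSetoid (χ : K →* ℂˣ) (M : Subgroup (inertiaGroup χ)) [M.Normal] :
    Setoid (IrrOver χ (inclG M)) where
  r ρ₁ ρ₂ := IsConjRep ρ₁.rep.ρ ρ₂.rep.ρ
  iseqv := ⟨fun _ => IsConjRep.rfl', IsConjRep.symm', IsConjRep.trans'⟩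

/-- The properties characterizing the subgroup in the theorem.  Here `C` is a subgroup of `G`,
`χ` is a linear character of the normal subgroup `K` of `G`, and `M` is a subgroup of the inertia
group `C_G(χ)`. -/
structure IsCliffordSubgroup (C : Subgroup G) (χ : K →* ℂˣ) (M : Subgroup (inertiaGroup χ)) :
    Prop where
  /-- `M` is normal in `C_G(χ)`. -/
  [normal : M.Normal]
  /-- `C ⊆ M`. -/
  le : C ≤ M.map (inertiaGroup χ).subtype
  /-- `χ` extends to a one-dimensional representation of `M`. -/
  extends_char : ∃ χ' : M →* ℂˣ, ∀ (m : M) (hm : inclG M m ∈ K), χ' m = χ ⟨inclG M m, hm⟩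
  /-- Every element of `Irr(M | χ)` induces irreducibly to `G`. -/
  ind_irreducible : ∀ ρ : IrrOver χ (inclG M), (ρ.rep.ρ.ind (inclG M)).IsIrreducible
  /-- Every element of `Irr(G | χ)` is induced from an element of `Irr(M | χ)`. -/
  ind_surjective : ∀ δ : IrrOver χ (MonoidHom.id G), ∃ ρ : IrrOver χ (inclG M),
    Nonempty (δ.rep.ρ.Equiv (ρ.rep.ρ.ind (inclG M)))
  /-- `M / K` is abelian, or the (internal) semidirect product of an abelian normal subgroup and a
  subgroup of order two. -/
  quotient_structure :
    (∀ x y : M ⧸ K.comap (inclG M), x * y = y * x) ∨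
    ∃ B D : Subgroup (M ⧸ K.comap (inclG M)),
      B.Normal ∧ (∀ x ∈ B, ∀ y ∈ B, x * y = y * x) ∧ Nat.card D = 2 ∧ B.IsComplement' D
  /-- Every element of `Irr(M | χ)` has dimension one or two. -/
  dim_one_or_two : ∀ ρ : IrrOver χ (inclG M),
    Module.finrank ℂ ρ.rep = 1 ∨ Module.finrank ℂ ρ.rep = 2
  /-- The classes of `Irr(M | χ)` under conjugation by `C_G(χ)` biject with `Irr(G | χ)`. -/
  bijection : Nonempty
    (Quotient (conjSetoid χ M) ≃ Quotient (isoSetoid χ (MonoidHom.id G)))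

/-- Induction `ρ ↦ Ind_M^G ρ` induces a bijection from the classes of `Irr(M | χ)` under
conjugation by `C_G(χ)` onto `Irr(G | χ)`. -/
def InductionBijective (χ : K →* ℂˣ) (M : Subgroup (inertiaGroup χ)) [M.Normal] : Prop :=
  ∃ Φ : Quotient (conjSetoid χ M) ≃ Quotient (isoSetoid χ (MonoidHom.id G)),
    ∀ (ρ : IrrOver χ (inclG M)) (δ : IrrOver χ (MonoidHom.id G)),
      Φ (Quotient.mk _ ρ) = Quotient.mk _ δ ↔ Nonempty (δ.rep.ρ.Equiv (ρ.rep.ρ.ind (inclG M)))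

end CliffordTheory

section Matrices

/-- `A` is cyclic: `{v, A v}` generates the free module `R²` for some vector `v`. -/
def IsCyclicMatrix {R : Type*} [CommRing R] (A : Matrix (Fin 2) (Fin 2) R) : Prop :=
  ∃ v : Fin 2 → R, Submodule.span R {v, A.mulVec v} = ⊤

variable (𝒪 : Type*) [CommRing 𝒪] [IsLocalRing 𝒪]

/-- `𝔬_n = 𝔬 / ℘^n`. -/
abbrev TruncRing (n : ℕ) : Type _ := 𝒪 ⧸ maximalIdeal 𝒪 ^ n

/-- The projection `𝔬_{2ℓ} → 𝔬_ℓ`. -/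
abbrev truncMap (ℓ : ℕ) : TruncRing 𝒪 (2 * ℓ) →+* TruncRing 𝒪 ℓ :=
  Ideal.Quotient.factor (Ideal.pow_le_pow_right (by omega))

variable {𝒪}

theorem truncMap_surjective (ℓ : ℕ) : Function.Surjective (truncMap 𝒪 ℓ) :=
  Ideal.Quotient.factor_surjective _

theorem mul_eq_zero_of_truncMap {ℓ : ℕ} {a b : TruncRing 𝒪 (2 * ℓ)}
    (ha : truncMap 𝒪 ℓ a = 0) (hb : truncMap 𝒪 ℓ b = 0) : a * b = 0 := by
  obtain ⟨x, rfl⟩ := Ideal.Quotient.mk_surjective a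
  obtain ⟨y, rfl⟩ := Ideal.Quotient.mk_surjective b
  rw [Ideal.Quotient.factor_mk, Ideal.Quotient.eq_zero_iff_mem] at ha hb
  rw [← map_mul, Ideal.Quotient.eq_zero_iff_mem, two_mul, pow_add]
  exact Ideal.mul_mem_mul ha hb

variable (𝒪)

/-- The congruence subgroup `M^ℓ = ker(GL₂(𝔬_{2ℓ}) → GL₂(𝔬_ℓ))`. -/
abbrev congGL (ℓ : ℕ) : Subgroup (GL (Fin 2) (TruncRing 𝒪 (2 * ℓ))) :=
  (Matrix.GeneralLinearGroup.map (truncMap 𝒪 ℓ)).ker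

/-- The congruence subgroup `K^ℓ = M^ℓ ∩ SL₂(𝔬_{2ℓ})`. -/
abbrev congSL (ℓ : ℕ) : Subgroup (Matrix.SpecialLinearGroup (Fin 2) (TruncRing 𝒪 (2 * ℓ))) :=
  (congGL 𝒪 ℓ).comap Matrix.SpecialLinearGroup.toGL

variable {𝒪}

/-- A lift of `A ∈ M₂(𝔬_ℓ)` to `M₂(𝔬_{2ℓ})`. -/
def liftMatrix {ℓ : ℕ} (A : Matrix (Fin 2) (Fin 2) (TruncRing 𝒪 ℓ)) :
    Matrix (Fin 2) (Fin 2) (TruncRing 𝒪 (2 * ℓ)) :=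
  A.map (Function.surjInv (truncMap_surjective ℓ))

theorem congGL_sub_one {ℓ : ℕ} (X : congGL 𝒪 ℓ) (i j : Fin 2) :
    truncMap 𝒪 ℓ ((X.1.1 - 1) i j) = 0 := by
  have h := X.2
  rw [MonoidHom.mem_ker] at h
  have h' := congrArg
    (fun Z : GL (Fin 2) (TruncRing 𝒪 ℓ) => Z.1 i j) h
  change truncMap 𝒪 ℓ (X.1.1 i j) = (1 : Matrix (Fin 2) (Fin 2) (TruncRing 𝒪 ℓ)) i j at h'
  rw [Matrix.sub_apply, map_sub, h', sub_eq_zero, Matrix.one_apply, Matrix.one_apply]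
  split_ifs <;> simp

/-- The character `ψ_A` of `M^ℓ`: `ψ_A(I + π^ℓ B) = ψ(π^ℓ tr(Â B))`, that is,
`ψ_A(X) = ψ(tr(Â (X - I)))`, where `Â` is a lift of `A`. -/
def psiA {ℓ : ℕ} (ψ : AddChar (TruncRing 𝒪 (2 * ℓ)) ℂˣ)
    (A : Matrix (Fin 2) (Fin 2) (TruncRing 𝒪 ℓ)) : congGL 𝒪 ℓ →* ℂˣ where
  toFun X := ψ (Matrix.trace (liftMatrix A *
    (X.1.1 - 1)))
  map_one' := by simp
  map_mul' X Y := by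
    rw [← AddChar.map_add_eq_mul, ← Matrix.trace_add, ← Matrix.mul_add]
    congr 3
    have h : (X.1.1 - 1) *
        (Y.1.1 - 1) = 0 := by
      ext i j
      rw [Matrix.mul_apply]
      exact Finset.sum_eq_zero fun k _ =>
        mul_eq_zero_of_truncMap (congGL_sub_one X i k) (congGL_sub_one Y k j)
    have h' : ((X * Y : congGL 𝒪 ℓ) : GL (Fin 2) (TruncRing 𝒪 (2 * ℓ))).1 =
        X.1.1 * Y.1.1 := rfl
    rw [h', ← sub_eq_zero, ← h]
    noncomm_ring

/-- `psiA` is given by the formula `ψ_A(I + π^ℓ B) = ψ(π^ℓ tr(Â B))` for every lift `Â`. -/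
theorem psiA_apply {ℓ : ℕ} (ψ : AddChar (TruncRing 𝒪 (2 * ℓ)) ℂˣ)
    (A : Matrix (Fin 2) (Fin 2) (TruncRing 𝒪 ℓ)) (X : congGL 𝒪 ℓ)
    (A' B : Matrix (Fin 2) (Fin 2) (TruncRing 𝒪 (2 * ℓ))) (hA' : A'.map (truncMap 𝒪 ℓ) = A)
    (p : 𝒪)
    (hX : X.1.1 = 1 + (Ideal.Quotient.mk _ (p ^ ℓ) : TruncRing 𝒪 (2 * ℓ)) • B) :
    psiA ψ A X = ψ (Ideal.Quotient.mk _ (p ^ ℓ) * Matrix.trace (A' * B)) := by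
  have hA : (liftMatrix A - A') *
      (X.1.1 - 1) = 0 := by
    ext i j
    rw [Matrix.mul_apply]
    refine Finset.sum_eq_zero fun k _ => mul_eq_zero_of_truncMap ?_ (congGL_sub_one X k j)
    rw [Matrix.sub_apply, map_sub, sub_eq_zero, ← hA']
    exact Function.surjInv_eq (truncMap_surjective ℓ) _
  rw [Matrix.sub_mul, sub_eq_zero] at hA
  change ψ (Matrix.trace (liftMatrix A * _)) = _
  rw [hA, hX, add_sub_cancel_left, Matrix.mul_smul, Matrix.trace_smul, smul_eq_mul]

/-- The character `ψ_{[A]}` of `K^ℓ`: the restriction of `ψ_A`. -/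
def psiBracket {ℓ : ℕ} (ψ : AddChar (TruncRing 𝒪 (2 * ℓ)) ℂˣ)
    (A : Matrix (Fin 2) (Fin 2) (TruncRing 𝒪 ℓ)) : congSL 𝒪 ℓ →* ℂˣ :=
  (psiA ψ A).comp (Matrix.SpecialLinearGroup.toGL.subgroupComap (congGL 𝒪 ℓ))

/-- `C_{SL₂(𝔬_{2ℓ})}(ψ_A)`: the elements of `SL₂(𝔬_{2ℓ})` stabilizing the character `ψ_A` of
`M^ℓ`. -/
def stabSL {ℓ : ℕ} (ψ : AddChar (TruncRing 𝒪 (2 * ℓ)) ℂˣ)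
    (A : Matrix (Fin 2) (Fin 2) (TruncRing 𝒪 ℓ)) :
    Subgroup (Matrix.SpecialLinearGroup (Fin 2) (TruncRing 𝒪 (2 * ℓ))) :=
  (inertiaGroup (psiA ψ A)).comap Matrix.SpecialLinearGroup.toGL

end Matrices

/-- The bound `R_𝔬`: it is `4e` if `𝔬` has characteristic zero and ramification index `e`
(the valuation of `2`, so that `2𝔬 = ℘^e`), and `2` if `𝔬` has characteristic two. -/
def boundR (𝒪 : Type*) [CommRing 𝒪] [IsDomain 𝒪] [IsDiscreteValuationRing 𝒪] : ℕ :=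
  if ringChar 𝒪 = 0 then 4 * (IsDiscreteValuationRing.addVal 𝒪 (2 : 𝒪)).toNat else 2

end

/-! Put χ = ψ_[A], let C be its stabilizer in S, and let N be C_S(ψ_A), seen inside C. Conjugation
by a lift of the matrix with columns v, Av turns A into the companion matrix of X² − tX + d. Then N
consists of the determinant-one matrices congruent to some p + qA modulo ℘^ℓ. It contains K, is
normal in C, and its commutators lie in K and are killed by χ, so χ extends to N. For g in C one has
g⁻¹Ag ≡ A + x with x scalar. Comparing traces and determinants gives 2x ≡ 0 and x² + tx ≡ 0, and
then the unipotent matrix u_x with entry x also moves A to A + x. Hence C = N·{u_x}, and these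
representatives commute and have squares in K (`exists_centralizesCompanion_mul`).

Let χ₁ run through the extensions of χ to N. Each χ₁ extends to its own stabilizer in C, because
commuting representatives cancel from commutators (`IsTransversalOver.apply_commutator_eq_one`). If
M contains all these stabilizers, then every element of Irr(M | χ) induces irreducibly
(`IrrOver.ind_isIrreducible`), and Clifford theory gives the bijection. So the required group is a
stabilizer containing all the others. It is unique: another candidate M' lies in some stabilizer,
hence in M, and if M' were smaller, a linear character of M restricted to M' would induce reducibly
(`le_of_extends_of_ind_isIrreducible`).

Existence rests on a dichotomy. If elements of stabilizers always commute with N modulo K, the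
condition to stabilize χ₁ reads χ([g, n]) = 1, which no longer involves χ₁: all stabilizers coincide
and are abelian over χ. Otherwise some u_x in a stabilizer fails to commute with N modulo K. By
`IsTrivialOnNormOne.sub_eq_zero`, any u_y in any stabilizer then has y ≡ 0 or y ≡ x. All stabilizers
lie in N ∪ N u_x, which yields the semidirect product and the bound two on dimensions. -/

noncomputable section

/-! ### Irreducibility, and induction realized on equivariant functions. -/

section RepresentationTheory

namespace Representation

variable {G H : Type*} [Group G] [Group H] {V W : Type*} [AddCommGroup V] [Module ℂ V]
  [AddCommGroup W] [Module ℂ W]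

theorem isIrreducible_iff_forall_submodule (ρ : Representation ℂ G V) :
    ρ.IsIrreducible ↔ Nontrivial V ∧
      ∀ U : Submodule ℂ V, (∀ g, ∀ v ∈ U, ρ g v ∈ U) → U = ⊥ ∨ U = ⊤ := by
  constructor
  · intro h
    refine ⟨?_, fun U hU => ?_⟩
    · obtain ⟨a, b, hab⟩ := h.toNontrivial
      by_contra hV
      rw [not_nontrivial_iff_subsingleton] at hV
      exact hab (Subrepresentation.toSubmodule_injective (Subsingleton.elim _ _))
    · rcases h.eq_bot_or_eq_top (⟨U, fun g v hv => hU g v hv⟩ : Subrepresentation ρ) with h | h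
      · exact Or.inl (congrArg Subrepresentation.toSubmodule h)
      · exact Or.inr (congrArg Subrepresentation.toSubmodule h)
  · rintro ⟨hV, h⟩
    have : Nontrivial (Subrepresentation ρ) := by
      refine ⟨⟨⊥, ⊤, fun hbt => ?_⟩⟩
      have : (⊥ : Submodule ℂ V) = ⊤ := congrArg Subrepresentation.toSubmodule hbt
      exact bot_ne_top this
    refine ⟨fun U => ?_⟩
    rcases h U.toSubmodule (fun g v hv => U.apply_mem_toSubmodule g hv) with h | h
    · exact Or.inl (Subrepresentation.toSubmodule_injective h)
    · exact Or.inr (Subrepresentation.toSubmodule_injective h)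

theorem Equiv.exists_linearEquiv {ρ : Representation ℂ G V} {σ : Representation ℂ G W}
    (e : ρ.Equiv σ) : ∃ E : V ≃ₗ[ℂ] W, ∀ g v, E (ρ g v) = σ g (E v) :=
  ⟨e.toLinearEquiv, fun g v => IntertwiningMap.isIntertwining _ _ e.toIntertwiningMap g v⟩

theorem Equiv.nonempty_of_linearEquiv {ρ : Representation ℂ G V} {σ : Representation ℂ G W}
    (E : V ≃ₗ[ℂ] W) (hE : ∀ g v, E (ρ g v) = σ g (E v)) : Nonempty (ρ.Equiv σ) :=
  ⟨Equiv.mk E fun g => LinearMap.ext fun v => hE g v⟩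

theorem Equiv.isIrreducible {ρ : Representation ℂ G V} {σ : Representation ℂ G W}
    (e : ρ.Equiv σ) (h : ρ.IsIrreducible) : σ.IsIrreducible := by
  obtain ⟨E, hE⟩ := e.exists_linearEquiv
  rw [isIrreducible_iff_forall_submodule] at h ⊢
  obtain ⟨hV, h⟩ := h
  refine ⟨E.symm.toEquiv.nontrivial, fun U hU => ?_⟩
  have key := h (U.comap E.toLinearMap) fun g v hv => by
    change E (ρ g v) ∈ U
    rw [hE]
    exact hU g _ hv
  have hmem : ∀ w, w ∈ U ↔ E.symm w ∈ U.comap E.toLinearMap := by simp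
  refine key.imp (fun hb => ?_) (fun ht => ?_)
  · rw [eq_bot_iff]
    intro w hw
    rw [hmem, hb, Submodule.mem_bot] at hw
    simpa using hw
  · rw [eq_top_iff]
    intro w _
    rw [hmem, ht]
    trivial

theorem IsIrreducible.finiteDimensional [Finite G] {ρ : Representation ℂ G V}
    (h : ρ.IsIrreducible) : FiniteDimensional ℂ V := by
  rw [isIrreducible_iff_forall_submodule] at h
  obtain ⟨⟨a, b, hab⟩, h⟩ := h
  let v := a - b
  have hv : v ≠ 0 := sub_ne_zero.2 hab
  have := h (Submodule.span ℂ (Set.range fun g => ρ g v)) (by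
    intro g w hw
    induction hw using Submodule.span_induction with
    | mem x hx =>
      obtain ⟨g', rfl⟩ := hx
      exact Submodule.subset_span ⟨g * g', by simp⟩
    | zero => simp
    | add x y _ _ hx hy => rw [map_add]; exact Submodule.add_mem _ hx hy
    | smul c x _ hx => rw [map_smul]; exact Submodule.smul_mem _ _ hx)
  have htop : Submodule.span ℂ (Set.range fun g => ρ g v) = ⊤ := by
    refine this.resolve_left fun hb => hv ?_
    have : v ∈ Submodule.span ℂ (Set.range fun g => ρ g v) :=
      Submodule.subset_span ⟨1, by simp⟩
    rwa [hb, Submodule.mem_bot] at this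
  exact ⟨by rw [← htop]; exact Submodule.fg_span (Set.finite_range _)⟩

/-- The restriction of a representation to a stable submodule. -/
def restrictTo (ρ : Representation ℂ G V) (U : Submodule ℂ V) (hU : ∀ g, ∀ v ∈ U, ρ g v ∈ U) :
    Representation ℂ G U :=
  Subrepresentation.toRepresentation ⟨U, fun g v hv => hU g v hv⟩

theorem exists_isIrreducible_le [FiniteDimensional ℂ V] (ρ : Representation ℂ G V)
    (U : Submodule ℂ V) (hU : ∀ g, ∀ v ∈ U, ρ g v ∈ U) (hU0 : U ≠ ⊥) :
    ∃ (U' : Submodule ℂ V) (hU' : ∀ g, ∀ v ∈ U', ρ g v ∈ U'), U' ≤ U ∧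
      (ρ.restrictTo U' hU').IsIrreducible := by
  induction hn : Module.finrank ℂ U using Nat.strong_induction_on generalizing U with
  | _ n ih =>
  by_cases hirr : (ρ.restrictTo U hU).IsIrreducible
  · exact ⟨U, hU, le_rfl, hirr⟩
  rw [isIrreducible_iff_forall_submodule] at hirr
  have hnt : Nontrivial U := Submodule.nontrivial_iff_ne_bot.2 hU0
  push Not at hirr
  obtain ⟨U₁, hU₁, hb, ht⟩ := hirr hnt
  have hlt : U₁.map U.subtype < U := by
    refine lt_of_le_of_ne (Submodule.map_subtype_le U U₁) fun he => ht ?_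
    rw [eq_top_iff]
    intro x _
    have hx : (x : V) ∈ U₁.map U.subtype := by rw [he]; exact x.2
    obtain ⟨y, hy, hyx⟩ := hx
    have : y = x := Subtype.ext hyx
    exact this ▸ hy
  obtain ⟨U', hU', hle, h⟩ := ih (Module.finrank ℂ (U₁.map U.subtype))
    (hn ▸ Submodule.finrank_lt_finrank_of_lt hlt) (U₁.map U.subtype) (by
      rintro g _ ⟨u, hu, rfl⟩
      exact ⟨ρ.restrictTo U hU g u, hU₁ g u hu, rfl⟩) (by
      intro h0
      apply hb
      exact (Submodule.map_injective_of_injective U.injective_subtype)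
        (h0.trans (Submodule.map_bot _).symm)) rfl
  exact ⟨U', hU', hle.trans hlt.le, h⟩

section Coinduction

variable (φ : H →* G) (ρ : Representation ℂ H V)

open Classical in
/-- The function on `G` supported on `φ(H) h` and with value `v` at `h` (if `φ` is injective). -/
def coindSingle [Fintype H] (h : G) : V →ₗ[ℂ] coindV φ ρ where
  toFun v := ⟨fun g => ∑ m : H, if φ m * h = g then ρ m v else 0, fun m g => by
    rw [map_sum]
    refine Fintype.sum_equiv (Equiv.mulLeft m⁻¹) _ _ fun m' => ?_
    have : φ m' * h = φ m * g ↔ φ (m⁻¹ * m') * h = g := by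
      rw [map_mul, map_inv, mul_assoc, inv_mul_eq_iff_eq_mul]
    rw [_root_.Equiv.coe_mulLeft]
    by_cases h' : φ (m⁻¹ * m') * h = g
    · rw [if_pos (this.2 h'), if_pos h', ← Module.End.mul_apply, ← map_mul,
        mul_inv_cancel_left]
    · rw [if_neg (mt this.1 h'), if_neg h', map_zero]⟩
  map_add' v w := by
    ext g
    simp only [map_add, Submodule.coe_add, Pi.add_apply, ← Finset.sum_add_distrib]
    refine Finset.sum_congr rfl fun m _ => ?_
    split_ifs <;> simp
  map_smul' c v := by
    ext g
    simp only [map_smul, Submodule.coe_smul, Pi.smul_apply, Finset.smul_sum, RingHom.id_apply]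
    refine Finset.sum_congr rfl fun m _ => ?_
    split_ifs <;> simp

open Classical in
theorem coindSingle_apply [Fintype H] (h g : G) (v : V) :
    (coindSingle φ ρ h v).1 g = ∑ m : H, if φ m * h = g then ρ m v else 0 := rfl

variable {φ} in
theorem coindSingle_apply_map [Fintype H] (hφ : Function.Injective φ) (m : H) (v : V) :
    (coindSingle φ ρ 1 v).1 (φ m) = ρ m v := by
  classical
  rw [coindSingle_apply, Finset.sum_eq_single m]
  · simp
  · intro m' _ hm'
    rw [if_neg]
    rw [mul_one]
    exact fun h => hm' (hφ h)
  · simp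

theorem coindSingle_apply_of_notMem [Fintype H] {g : G} (hg : g ∉ φ.range) (v : V) :
    (coindSingle φ ρ 1 v).1 g = 0 := by
  classical
  rw [coindSingle_apply]
  refine Finset.sum_eq_zero fun m _ => if_neg fun h => hg ⟨m, ?_⟩
  rw [← h, mul_one]

theorem coind_apply_apply (g : G) (f : coindV φ ρ) (x : G) :
    (coind φ ρ g f).1 x = f.1 (x * g) := rfl

theorem coind_coindSingle [Fintype H] (h g : G) (v : V) :
    coind φ ρ g (coindSingle φ ρ h v) = coindSingle φ ρ (h * g⁻¹) v := by
  classical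
  ext x
  rw [coind_apply_apply, coindSingle_apply, coindSingle_apply]
  refine Finset.sum_congr rfl fun m _ => ?_
  have : φ m * (h * g⁻¹) = x ↔ φ m * h = x * g := by
    rw [← mul_assoc, mul_inv_eq_iff_eq_mul]
  simp only [this]

theorem coindSingle_map_mul [Fintype H] (m : H) (h : G) (v : V) :
    coindSingle φ ρ (φ m * h) (ρ m v) = coindSingle φ ρ h v := by
  classical
  ext x
  rw [coindSingle_apply, coindSingle_apply]
  refine Fintype.sum_equiv (Equiv.mulRight m) _ _ fun m' => ?_
  simp only [_root_.Equiv.coe_mulRight, map_mul, mul_assoc, Module.End.mul_apply]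

theorem sum_coindSingle [Fintype G] [Fintype H] (f : coindV φ ρ) :
    ∑ g : G, coindSingle φ ρ g (f.1 g) = (Fintype.card H : ℂ) • f := by
  classical
  ext x
  have h1 : (∑ g : G, coindSingle φ ρ g (f.1 g)).1 x
      = ∑ g : G, (coindSingle φ ρ g (f.1 g)).1 x := by
    rw [← Submodule.subtype_apply, map_sum, Finset.sum_apply]
    rfl
  rw [h1]
  simp only [coindSingle_apply]
  rw [Finset.sum_comm]
  have h2 : ∀ m : H, (∑ g : G, if φ m * g = x then ρ m (f.1 g) else 0) = f.1 x := by
    intro m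
    rw [Finset.sum_eq_single ((φ m)⁻¹ * x)]
    · rw [if_pos (mul_inv_cancel_left _ _), ← f.2, mul_inv_cancel_left]
    · intro g _ hg
      rw [if_neg]
      rintro rfl
      exact hg (by simp)
    · simp
  simp [h2, Nat.cast_smul_eq_nsmul]

/-- The induced and the coinduced representation of a finite group are isomorphic. -/
def indEquivCoind [Fintype G] [Fintype H] : (ind φ ρ).Equiv (coind φ ρ) := by
  classical
  have hH : (Fintype.card H : ℂ) ≠ 0 := Nat.cast_ne_zero.2 Fintype.card_ne_zero
  let F : TensorProduct ℂ (MonoidAlgebra ℂ G) V →ₗ[ℂ] coindV φ ρ :=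
    TensorProduct.lift ((Finsupp.lift _ _ _ fun h => coindSingle φ ρ h) ∘ₗ
      (MonoidAlgebra.coeffLinearEquiv ℂ).toLinearMap)
  have hF : ∀ h v, F (MonoidAlgebra.single h 1 ⊗ₜ v) = coindSingle φ ρ h v := by
    intro h v
    simp [F]
  let Φ : IndV φ ρ →ₗ[ℂ] coindV φ ρ := Coinvariants.lift _ F fun m => by
    ext h x : 4
    simp only [LinearMap.coe_comp, Function.comp_apply, MonoidAlgebra.lsingle_apply,
      TensorProduct.AlgebraTensorModule.curry_apply, LinearMap.coe_restrictScalars,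
      TensorProduct.curry_apply, tprod_apply, TensorProduct.map_tmul]
    simp only [MonoidHom.coe_comp, Function.comp_apply, leftRegular, ofMulAction_single,
      smul_eq_mul]
    rw [hF, hF, coindSingle_map_mul]
  have hΦ : ∀ h v, Φ (IndV.mk φ ρ h v) = coindSingle φ ρ h v := fun h v => hF h v
  -- The sum over G counts each coset of H once for every element of H, whence the factor |H|⁻¹.
  let Ψ : coindV φ ρ →ₗ[ℂ] IndV φ ρ := (Fintype.card H : ℂ)⁻¹ •
    ∑ g : G, IndV.mk φ ρ g ∘ₗ LinearMap.proj g ∘ₗ (coindV φ ρ).subtype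
  have hΨ : ∀ f, Ψ f = (Fintype.card H : ℂ)⁻¹ • ∑ g : G, IndV.mk φ ρ g (f.1 g) := by
    intro f
    simp [Ψ]
  have hmk : ∀ m h v, IndV.mk φ ρ (φ m * h) (ρ m v) = IndV.mk φ ρ h v := by
    intro m h v
    refine (Coinvariants.mk_eq_iff _).2 ?_
    refine Coinvariants.mem_ker_of_eq m (MonoidAlgebra.single h 1 ⊗ₜ v) _ ?_
    simp [leftRegular]
  refine Equiv.mk (LinearEquiv.ofLinearMap Φ Ψ ?_ ?_) ?_
  · refine LinearMap.ext fun f => ?_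
    change Φ (Ψ f) = f
    rw [hΨ, map_smul, map_sum, Finset.sum_congr rfl fun g _ => hΦ g _, sum_coindSingle,
      smul_smul, inv_mul_cancel₀ hH, one_smul]
  · refine IndV.hom_ext φ ρ fun h => LinearMap.ext fun v => ?_
    change Ψ (Φ (IndV.mk φ ρ h v)) = IndV.mk φ ρ h v
    rw [hΦ, hΨ, inv_smul_eq_iff₀ hH]
    have h1 : ∀ g : G, IndV.mk φ ρ g ((coindSingle φ ρ h v).1 g) =
        ∑ m : H, IndV.mk φ ρ g (if φ m * h = g then ρ m v else 0) := fun g => by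
      rw [coindSingle_apply, map_sum]
    rw [Finset.sum_congr rfl fun g _ => h1 g, Finset.sum_comm]
    have h2 : ∀ m : H, (∑ g : G, IndV.mk φ ρ g (if φ m * h = g then ρ m v else 0)) =
        IndV.mk φ ρ h v := by
      intro m
      rw [Finset.sum_eq_single (φ m * h)]
      · rw [if_pos rfl, hmk]
      · intro g _ hg
        rw [if_neg (Ne.symm hg), map_zero]
      · exact fun h => (h (Finset.mem_univ _)).elim
    rw [Finset.sum_congr rfl fun m _ => h2 m, Finset.sum_const, Finset.card_univ,
      Nat.cast_smul_eq_nsmul]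
  · intro g
    refine IndV.hom_ext φ ρ fun h => LinearMap.ext fun v => ?_
    change Φ (ind φ ρ g (IndV.mk φ ρ h v)) = coind φ ρ g (Φ (IndV.mk φ ρ h v))
    rw [ind_mk, hΦ, hΦ, coind_coindSingle]

end Coinduction

end Representation

end RepresentationTheory

/-! ### Eigenvectors of subgroups in irreducible representations. -/

section RepresentationTheory

namespace Representation

variable {G H N : Type*} [Group G] [Group H] [Group N] {V W : Type*} [AddCommGroup V]
  [Module ℂ V] [AddCommGroup W] [Module ℂ W]

theorem IsIrreducible.eq_top_of_mem {ρ : Representation ℂ G V} (h : ρ.IsIrreducible)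
    {U : Submodule ℂ V} (hU : ∀ g, ∀ v ∈ U, ρ g v ∈ U) {v : V} (hv : v ∈ U) (hv0 : v ≠ 0) :
    U = ⊤ := by
  refine (((isIrreducible_iff_forall_submodule ρ).1 h).2 U hU).resolve_left fun hb => hv0 ?_
  rwa [hb, Submodule.mem_bot] at hv

theorem IsIrreducible.nontrivial {ρ : Representation ℂ G V} (h : ρ.IsIrreducible) :
    Nontrivial V :=
  ((isIrreducible_iff_forall_submodule ρ).1 h).1

theorem IsIrreducible.span_orbit_eq_top {ρ : Representation ℂ G V} (h : ρ.IsIrreducible)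
    {v : V} (hv : v ≠ 0) : Submodule.span ℂ (Set.range fun g => ρ g v) = ⊤ := by
  refine h.eq_top_of_mem (fun g w hw => ?_) (Submodule.subset_span ⟨1, by simp⟩) hv
  induction hw using Submodule.span_induction with
  | mem x hx =>
    obtain ⟨g', rfl⟩ := hx
    exact Submodule.subset_span ⟨g * g', by simp⟩
  | zero => simp
  | add x y _ _ hx hy => rw [map_add]; exact Submodule.add_mem _ hx hy
  | smul c x _ hx => rw [map_smul]; exact Submodule.smul_mem _ _ hx

theorem exists_isCompl_stable [Finite G] (ρ : Representation ℂ G V) (U : Submodule ℂ V)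
    (hU : ∀ g, ∀ v ∈ U, ρ g v ∈ U) :
    ∃ U' : Submodule ℂ V, (∀ g, ∀ v ∈ U', ρ g v ∈ U') ∧ IsCompl U U' := by
  have hne : NeZero (Nat.card G : ℂ) := ⟨Nat.cast_ne_zero.2 Nat.card_pos.ne'⟩
  obtain ⟨U', h⟩ := exists_isCompl (⟨U, fun g v hv => hU g v hv⟩ : Subrepresentation ρ)
  refine ⟨U'.toSubmodule, fun g v hv => U'.apply_mem_toSubmodule g hv, ?_⟩
  exact ⟨disjoint_iff.2 (congrArg Subrepresentation.toSubmodule h.inf_eq_bot),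
    codisjoint_iff.2 (congrArg Subrepresentation.toSubmodule h.sup_eq_top)⟩

/-- A substitute for Mackey's criterion. A common eigenvector supported on the image of H is
determined by its value at 1; since ρ is irreducible, a stable subspace containing such a vector
contains every function supported there, and the translates of these span. -/
theorem coind_isIrreducible_of_support [Finite G] {φ : H →* G} (hφ : Function.Injective φ)
    {ρ : Representation ℂ H V} (hρ : ρ.IsIrreducible) {ι : Type*} (i : ι → H) (c : ι → ℂ) {v₀ : V}
    (hv₀ : v₀ ≠ 0) (heig : ∀ n, ρ (i n) v₀ = c n • v₀)
    (hsupp : ∀ f : coindV φ ρ, (∀ n g, f.1 (g * φ (i n)) = c n • f.1 g) →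
      ∀ g, f.1 g ≠ 0 → g ∈ φ.range) : (coind φ ρ).IsIrreducible := by
  have := Fintype.ofFinite G
  have : Finite H := Finite.of_injective φ hφ
  have := Fintype.ofFinite H
  have hH : (Fintype.card H : ℂ) ≠ 0 := Nat.cast_ne_zero.2 Fintype.card_ne_zero
  have hone : ∀ v, (coindSingle φ ρ 1 v).1 1 = v := fun v => by
    simpa using coindSingle_apply_map ρ hφ 1 v
  have htop : ∀ (U : Submodule ℂ (coindV φ ρ)), (∀ g, ∀ f ∈ U, coind φ ρ g f ∈ U) →
      ∀ u ∈ U, u ≠ 0 → (∀ n, coind φ ρ (φ (i n)) u = c n • u) → U = ⊤ := by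
    intro U hU u hu hu0 hun
    have hsu := hsupp u fun n g => by
      rw [← coind_apply_apply, hun n]
      rfl
    have hus : u = coindSingle φ ρ 1 (u.1 1) := by
      ext g
      by_cases hg : g ∈ φ.range
      · obtain ⟨m, rfl⟩ := hg
        rw [coindSingle_apply_map ρ hφ, ← u.2, mul_one]
      · rw [coindSingle_apply_of_notMem φ ρ hg]
        exact not_not.1 (mt (hsu g) hg)
    have hmem : ∀ v, coindSingle φ ρ 1 v ∈ U := by
      have : U.comap (coindSingle φ ρ 1) = ⊤ := by
        refine hρ.eq_top_of_mem (v := u.1 1) (fun m v hv => ?_) ?_ ?_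
        · have := hU (φ m) _ hv
          rw [coind_coindSingle, ← coindSingle_map_mul φ ρ m, one_mul, mul_inv_cancel] at this
          exact this
        · rw [Submodule.mem_comap, ← hus]
          exact hu
        · intro h0
          rw [h0, map_zero] at hus
          exact hu0 hus
      intro v
      have hv : v ∈ U.comap (coindSingle φ ρ 1) := this ▸ Submodule.mem_top
      exact hv
    rw [eq_top_iff]
    intro f _
    have hf := sum_coindSingle φ ρ f
    rw [← inv_smul_eq_iff₀ hH] at hf
    rw [← hf]
    refine U.smul_mem _ (U.sum_mem fun g _ => ?_)
    have := hU g⁻¹ _ (hmem (f.1 g))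
    rwa [coind_coindSingle, one_mul, inv_inv] at this
  rw [isIrreducible_iff_forall_submodule]
  have hf0 : coindSingle φ ρ 1 v₀ ≠ 0 := fun h0 => hv₀ (by
    rw [← hone v₀, h0]
    rfl)
  refine ⟨⟨⟨_, _, hf0⟩⟩, fun U hU => ?_⟩
  -- Along a stable complement the eigenvector attached to v₀ splits into two components with the
  -- same eigenvalues. Whichever component is nonzero forces its summand to be everything.
  obtain ⟨U', hU', hc⟩ := exists_isCompl_stable _ U hU
  have hmem : coindSingle φ ρ 1 v₀ ∈ U ⊔ U' := hc.sup_eq_top ▸ Submodule.mem_top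
  obtain ⟨u, hu, u', hu', huu⟩ := Submodule.mem_sup.1 hmem
  have hn0 : ∀ n, coind φ ρ (φ (i n)) (coindSingle φ ρ 1 v₀) =
      c n • coindSingle φ ρ 1 v₀ := by
    intro n
    rw [coind_coindSingle, ← coindSingle_map_mul φ ρ (i n), one_mul, mul_inv_cancel, heig n,
      map_smul]
  have hsum : ∀ n, (coind φ ρ (φ (i n)) u - c n • u) + (coind φ ρ (φ (i n)) u' - c n • u') = 0 := by
    intro n
    have := hn0 n
    rw [← huu, map_add, smul_add] at this
    rw [← sub_eq_zero] at this
    rw [← this]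
    abel
  have hz : ∀ n, coind φ ρ (φ (i n)) u - c n • u = 0 := by
    intro n
    have h1 : coind φ ρ (φ (i n)) u - c n • u ∈ U := U.sub_mem (hU _ _ hu) (U.smul_mem _ hu)
    have h2 : coind φ ρ (φ (i n)) u - c n • u ∈ U' := by
      rw [eq_neg_of_add_eq_zero_left (hsum n)]
      exact U'.neg_mem (U'.sub_mem (hU' _ _ hu') (U'.smul_mem _ hu'))
    exact (Submodule.mem_bot ℂ).1 (hc.inf_eq_bot ▸ Submodule.mem_inf.2 ⟨h1, h2⟩)
  by_cases hu0 : u = 0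
  · left
    have : U' = ⊤ := by
      refine htop U' hU' u' hu' (fun h => ?_) fun n => ?_
      · rw [hu0, h, add_zero] at huu
        exact hf0 huu.symm
      · have := hsum n
        rw [hz n, zero_add] at this
        exact sub_eq_zero.1 this
    have hb := hc.inf_eq_bot
    rwa [this, inf_top_eq] at hb
  · exact Or.inr (htop U hU u hu hu0 fun n => sub_eq_zero.1 (hz n))

theorem IsIrreducible.exists_monoidHom_of_commute [Finite G] {ρ : Representation ℂ G V}
    (h : ρ.IsIrreducible) (hcomm : ∀ a b, ρ a * ρ b = ρ b * ρ a) :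
    ∃ χ : G →* ℂˣ, ∀ g v, ρ g v = (χ g : ℂ) • v := by
  have hfd := h.finiteDimensional
  have hnt := h.nontrivial
  have hs : ∀ g, ∃ c : ℂ, ∀ v, ρ g v = c • v := by
    intro g
    let F : IntertwiningMap ρ ρ := ⟨ρ g, fun a => hcomm g a⟩
    obtain ⟨c, hc⟩ := (IsIrreducible.algebraMap_intertwiningMap_bijective_of_isAlgClosed
      (ρ := ρ)).2 F
    refine ⟨c, fun v => ?_⟩
    change F v = _
    rw [← hc]
    rfl
  choose c hc using hs
  obtain ⟨v, hv⟩ := exists_ne (0 : V)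
  let χ : G →* ℂ :=
    { toFun := c
      map_one' := by
        have := hc 1 v
        rw [map_one, Module.End.one_apply] at this
        have h1 : c 1 • v = (1 : ℂ) • v := by rw [← this, one_smul]
        exact smul_left_injective ℂ hv h1
      map_mul' := fun a b => by
        refine smul_left_injective ℂ hv ?_
        change c (a * b) • v = (c a * c b) • v
        rw [← hc, map_mul, Module.End.mul_apply, hc b, map_smul, hc a, smul_smul, mul_comm] }
  exact ⟨χ.toHomUnits, fun g v => hc g v⟩

theorem exists_eigenvector_of_commute [Finite G] [FiniteDimensional ℂ V] [Nontrivial V]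
    (ρ : Representation ℂ G V) (hcomm : ∀ a b, ρ a * ρ b = ρ b * ρ a) :
    ∃ (χ : G →* ℂˣ) (v : V), v ≠ 0 ∧ ∀ g, ρ g v = (χ g : ℂ) • v := by
  obtain ⟨U, hU, -, hirr⟩ := ρ.exists_isIrreducible_le ⊤ (fun _ _ _ => Submodule.mem_top) top_ne_bot
  obtain ⟨χ, hχ⟩ := hirr.exists_monoidHom_of_commute fun a b => by
    ext u
    exact congrArg (fun F : Module.End ℂ V => F u) (hcomm a b)
  have := hirr.nontrivial
  obtain ⟨u, hu⟩ := exists_ne (0 : U)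
  exact ⟨χ, u, by simpa using hu, fun g => congrArg Subtype.val (hχ g u)⟩

/-- The characters of the common eigenvectors of a normal subgroup in an irreducible
representation form a single orbit. -/
theorem IsIrreducible.exists_conj_of_eigenvector [Finite G] [Finite N]
    {ρ : Representation ℂ G V} (h : ρ.IsIrreducible) (i : N →* G) (α : G → N →* N)
    (hα : ∀ g n, i (α g n) = g⁻¹ * i n * g) {χ₁ χ₂ : N →* ℂˣ} {v₁ v₂ : V} (hv₁ : v₁ ≠ 0)
    (hv₂ : v₂ ≠ 0) (h₁ : ∀ n, ρ (i n) v₁ = (χ₁ n : ℂ) • v₁)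
    (h₂ : ∀ n, ρ (i n) v₂ = (χ₂ n : ℂ) • v₂) :
    ∃ g, ∀ n, χ₂ n = χ₁ (α g n) := by
  have := Fintype.ofFinite N
  by_contra hcon
  push Not at hcon
  -- Up to the factor |N|, this is the projector to the χ₂-eigenspace. If χ₂ is not conjugate to χ₁,
  -- orthogonality of characters makes it kill the orbit of v₁, hence everything, yet it does not
  -- kill v₂.
  let e : V →ₗ[ℂ] V := ∑ n : N, ((χ₂ n)⁻¹ : ℂˣ).val • ρ (i n)
  have he : ∀ v, e v = ∑ n : N, ((χ₂ n)⁻¹ : ℂˣ).val • ρ (i n) v := fun v => by simp [e]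
  have he0 : e = 0 := by
    refine LinearMap.ext_on_range (h.span_orbit_eq_top hv₁) fun g => ?_
    have hg : ∀ n, ρ (i n) (ρ g v₁) = (χ₁ (α g n) : ℂ) • ρ g v₁ := by
      intro n
      rw [← map_smul, ← h₁, hα, ← Module.End.mul_apply, ← Module.End.mul_apply, ← map_mul,
        ← map_mul]
      congr 2
      group
    rw [he, LinearMap.zero_apply]
    simp only [hg, smul_smul, ← Finset.sum_smul]
    let ξ : N →* ℂ := (Units.coeHom ℂ).comp (χ₂⁻¹ * χ₁.comp (α g))
    have hξ : ξ ≠ 1 := by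
      intro h1
      obtain ⟨n, hn⟩ := hcon g
      apply hn
      have : ((χ₂ n)⁻¹ * χ₁ (α g n) : ℂˣ) = 1 := by
        ext
        exact DFunLike.congr_fun h1 n
      exact (inv_mul_eq_one.1 this)
    have := sum_hom_units_eq_zero ξ hξ
    have h2 : (∑ n : N, ((χ₂ n)⁻¹ : ℂˣ).val * (χ₁ (α g n) : ℂ)) = 0 := by
      rw [← this]
      rfl
    rw [h2, zero_smul]
  have hev : e v₂ = (Fintype.card N : ℂ) • v₂ := by
    rw [he]
    simp only [h₂, smul_smul, Units.inv_mul, one_smul, Finset.sum_const, Finset.card_univ,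
      Nat.cast_smul_eq_nsmul]
  rw [he0, LinearMap.zero_apply] at hev
  exact hv₂ ((smul_eq_zero.1 hev.symm).resolve_left (Nat.cast_ne_zero.2 Fintype.card_ne_zero))

end Representation

open Representation

theorem charRep_apply {H : Type*} [Group H] (χ : H →* ℂˣ) (h : H) (z : ℂ) :
    charRep χ h z = (χ h : ℂ) * z := rfl

/-- An irreducible representation is a constituent of the representation induced from a linear
character if and only if it contains a corresponding eigenvector. -/
theorem exists_injective_ind_charRep_iff {H : Type*} [Group H] [Finite H] {L : Subgroup H}
    (χ : L →* ℂˣ) {V : Type*} [AddCommGroup V] [Module ℂ V] {σ : Representation ℂ H V}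
    (hσ : σ.IsIrreducible) :
    (∃ T : σ.IntertwiningMap (Representation.ind L.subtype (charRep χ)), Function.Injective T) ↔
      ∃ w : V, w ≠ 0 ∧ ∀ l : L, σ l w = (χ l : ℂ) • w := by
  have := Fintype.ofFinite H
  have := Fintype.ofFinite L
  let E := indEquivCoind L.subtype (charRep χ)
  constructor
  · rintro ⟨T, hT⟩
    let T' := E.toIntertwiningMap.comp T
    have hT' : Function.Injective T' := (EquivLike.injective E).comp hT
    have := hσ.nontrivial
    obtain ⟨w, hw⟩ := exists_ne (0 : V)
    have hTw : T' w ≠ 0 := fun h0 => hw (hT' (h0.trans (map_zero T').symm))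
    obtain ⟨g, hg⟩ : ∃ g, (T' w).1 g ≠ 0 := by
      by_contra hcon
      push Not at hcon
      exact hTw (Subtype.ext (funext hcon))
    have hT1 : ∀ a u x, (T' (σ a u)).1 x = (T' u).1 (x * a) := by
      intro a u x
      have : T' (σ a u) = coind L.subtype (charRep χ) a (T' u) :=
        IntertwiningMap.isIntertwining _ _ T' a u
      rw [this, coind_apply_apply]
    -- The χ-component of g w, up to a scalar. Its image under T' takes the nonzero value |L|·(T'
    -- w)(g) at 1.
    refine ⟨∑ l : L, ((χ l)⁻¹ : ℂˣ).val • σ l (σ g w), ?_, fun l => ?_⟩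
    · intro h0
      have h1 := congrArg (fun u => (T' u).1 1) h0
      have h2 : ∀ l : L, (T' (((χ l)⁻¹ : ℂˣ).val • σ l (σ g w))).1 1 = (T' w).1 g := by
        intro l
        rw [map_smul]
        change ((χ l)⁻¹ : ℂˣ).val • (T' (σ l (σ g w))).1 1 = _
        rw [hT1, hT1, one_mul]
        have := (T' w).2 l g
        rw [charRep_apply] at this
        rw [Subgroup.subtype_apply] at this
        rw [this, smul_eq_mul, ← mul_assoc, Units.inv_mul, one_mul]
      have h3 : (T' (∑ l : L, ((χ l)⁻¹ : ℂˣ).val • σ l (σ g w))).1 1 =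
          ∑ l : L, (T' (((χ l)⁻¹ : ℂˣ).val • σ l (σ g w))).1 1 := by
        rw [map_sum, ← Submodule.subtype_apply, map_sum, Finset.sum_apply]
        rfl
      simp only [h3, h2, map_zero, Finset.sum_const, Finset.card_univ] at h1
      have h4 : (Fintype.card L : ℂ) * (T' w).1 g = 0 := by
        rw [← nsmul_eq_mul]
        exact h1
      exact hg ((mul_eq_zero.1 h4).resolve_left (Nat.cast_ne_zero.2 Fintype.card_ne_zero))
    · rw [map_sum, Finset.smul_sum]
      refine Fintype.sum_equiv (_root_.Equiv.mulLeft l) _ _ fun l' => ?_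
      rw [_root_.Equiv.coe_mulLeft, map_smul, smul_smul, Subgroup.coe_mul, map_mul σ,
        Module.End.mul_apply, map_mul χ, mul_inv, Units.val_mul, ← mul_assoc, Units.mul_inv, one_mul]
  · rintro ⟨w, hw, hl⟩
    obtain ⟨lam, hlam⟩ : ∃ lam : V →ₗ[ℂ] ℂ, lam w ≠ 0 := by
      by_contra hcon
      push Not at hcon
      exact hw ((Module.forall_dual_apply_eq_zero_iff ℂ w).1 hcon)
    -- Averaging makes the functional χ-equivariant under L without killing w. The functions x ↦ μ(x
    -- v) then embed V into the coinduced representation.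
    let μ : V →ₗ[ℂ] ℂ := ∑ l : L, ((χ l)⁻¹ : ℂˣ).val • lam ∘ₗ σ l
    have hμ : ∀ v, μ v = ∑ l : L, ((χ l)⁻¹ : ℂˣ).val • lam (σ l v) := fun v => by simp [μ]
    have hμl : ∀ (l : L) v, μ (σ l v) = (χ l : ℂ) * μ v := by
      intro l v
      rw [hμ, hμ, Finset.mul_sum]
      refine Fintype.sum_equiv (_root_.Equiv.mulRight l) _ _ fun l' => ?_
      rw [_root_.Equiv.coe_mulRight, Subgroup.coe_mul, map_mul σ, Module.End.mul_apply, map_mul χ,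
        mul_inv, Units.val_mul, smul_eq_mul, smul_eq_mul]
      linear_combination (-((χ l')⁻¹ : ℂˣ).val * lam (σ l' (σ l v))) * Units.mul_inv (χ l)
    have hμw : μ w ≠ 0 := by
      rw [hμ]
      simp only [hl, map_smul, smul_smul, Units.inv_mul, one_smul, Finset.sum_const,
        Finset.card_univ, nsmul_eq_mul]
      exact mul_ne_zero (Nat.cast_ne_zero.2 Fintype.card_ne_zero) hlam
    let F : σ.IntertwiningMap (coind L.subtype (charRep χ)) :=
      ⟨{ toFun := fun v => ⟨fun x => μ (σ x v), fun l x => by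
            change μ (σ (l * x) v) = (χ l : ℂ) * μ (σ x v)
            rw [map_mul, Module.End.mul_apply]
            exact hμl l _⟩
         map_add' := fun a b => by ext x; simp
         map_smul' := fun a b => by ext x; simp }, fun g => by
        ext v x
        change μ (σ x (σ g v)) = μ (σ (x * g) v)
        rw [map_mul, Module.End.mul_apply]⟩
    have hF : Function.Injective F := by
      refine (IsIrreducible.injective_or_eq_zero F).resolve_right fun h0 => hμw ?_
      have h1 : (F w).1 1 = 0 := by rw [h0]; rfl
      have h2 : (F w).1 1 = μ (σ 1 w) := rfl
      rwa [h2, map_one, Module.End.one_apply] at h1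
    exact ⟨E.symm.toIntertwiningMap.comp F, (EquivLike.injective E.symm).comp hF⟩

end RepresentationTheory

/-! ### Representations over χ, and irreducibility of induction from M. -/

section CliffordTheory

open Representation

variable {G : Type*} [Group G] {K : Subgroup G}

/-- Frobenius reciprocity in the form used from here on: lying over χ means containing an
eigenvector for it. -/
theorem constituent_iff_exists_eigenvector (χ : K →* ℂˣ) {H : Type*} [Group H] [Finite H]
    (f : H →* G) {V : Type*} [AddCommGroup V] [Module ℂ V] {σ : Representation ℂ H V}
    (hσ : σ.IsIrreducible) :
    (∃ T : σ.IntertwiningMap (Representation.ind (K.comap f).subtype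
        (charRep (χ.comp (f.subgroupComap K)))), Function.Injective T) ↔
      ∃ w : V, w ≠ 0 ∧ ∀ (h : H) (hk : f h ∈ K), σ h w = (χ ⟨f h, hk⟩ : ℂ) • w := by
  rw [exists_injective_ind_charRep_iff _ hσ]
  exact exists_congr fun w => and_congr_right fun _ =>
    ⟨fun h l hl => h ⟨l, hl⟩, fun h l => h l l.2⟩

/-- The element of `Irr(H | χ)` given by an irreducible representation containing an eigenvector
with character `χ`. -/
theorem exists_irrOver (χ : K →* ℂˣ) {H : Type*} [Group H] [Finite H] (f : H →* G)
    {V : Type*} [AddCommGroup V] [Module ℂ V] {σ : Representation ℂ H V} (hσ : σ.IsIrreducible)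
    {w : V} (hw : w ≠ 0) (hk : ∀ (h : H) (hk : f h ∈ K), σ h w = (χ ⟨f h, hk⟩ : ℂ) • w) :
    ∃ δ : IrrOver χ f, Nonempty (δ.rep.ρ.Equiv σ) := by
  have := hσ.finiteDimensional
  -- `IrrOver` asks for a space in `Type`, so σ is transported to coordinates.
  let E : V ≃ₗ[ℂ] (Fin (Module.finrank ℂ V) → ℂ) := LinearEquiv.ofFinrankEq _ _ (by simp)
  let τ : Representation ℂ H (Fin (Module.finrank ℂ V) → ℂ) :=
    { toFun := fun h => E.toLinearMap ∘ₗ σ h ∘ₗ E.symm.toLinearMap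
      map_one' := by ext; simp
      map_mul' := fun a b => by ext; simp }
  have hτ : ∀ h v, τ h v = E (σ h (E.symm v)) := fun _ _ => rfl
  have hE : ∀ h v, E (σ h v) = τ h (E v) := fun h v => by rw [hτ, E.symm_apply_apply]
  obtain ⟨e⟩ := Equiv.nonempty_of_linearEquiv E hE
  have hτirr := e.isIrreducible hσ
  refine ⟨⟨Rep.of τ, hτirr, (constituent_iff_exists_eigenvector χ f hτirr).2
    ⟨E w, by simpa using hw, fun h hm => ?_⟩⟩, ⟨e.symm⟩⟩
  rw [← hE, hk h hm, map_smul]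

theorem IrrOver.exists_eigenvector {χ : K →* ℂˣ} {H : Type*} [Group H] [Finite H] {f : H →* G}
    (ρ : IrrOver χ f) :
    ∃ w : ρ.rep, w ≠ 0 ∧ ∀ (h : H) (hk : f h ∈ K), ρ.rep.ρ h w = (χ ⟨f h, hk⟩ : ℂ) • w :=
  (constituent_iff_exists_eigenvector χ f ρ.irreducible).1 ρ.constituent

variable [K.Normal] {χ : K →* ℂˣ}

theorem le_inertiaGroup (χ : K →* ℂˣ) : K ≤ inertiaGroup χ := by
  intro k hk n
  have : MulAut.conjNormal k n = (⟨k, hk⟩ : K) * n * ⟨k, hk⟩⁻¹ := Subtype.ext rfl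
  rw [this, map_mul, map_mul, map_inv, mul_comm, inv_mul_cancel_left]

theorem inertiaGroup_apply_conj {c : G} (hc : c ∈ inertiaGroup χ) {k : G} (hk : k ∈ K)
    (hk' : c * k * c⁻¹ ∈ K) : χ ⟨c * k * c⁻¹, hk'⟩ = χ ⟨k, hk⟩ :=
  hc ⟨k, hk⟩

theorem inclG_injective (M : Subgroup (inertiaGroup χ)) : Function.Injective (inclG M) :=
  (Subgroup.subtype_injective _).comp (Subgroup.subtype_injective _)

theorem inclG_apply (M : Subgroup (inertiaGroup χ)) (m : M) : inclG M m = ((m : inertiaGroup χ) : G) :=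
  rfl

/-- The eigenspace of `χ` in a representation is stable under the inertia group of `χ`. -/
def eigenspaceOver (χ : K →* ℂˣ) {H : Type*} [Group H] (f : H →* G) {V : Type*} [AddCommGroup V]
    [Module ℂ V] (σ : Representation ℂ H V) : Submodule ℂ V where
  carrier := {w | ∀ (h : H) (hk : f h ∈ K), σ h w = (χ ⟨f h, hk⟩ : ℂ) • w}
  add_mem' ha hb h hk := by rw [map_add, ha h hk, hb h hk, smul_add]
  zero_mem' h hk := by simp
  smul_mem' c w hw h hk := by rw [map_smul, hw h hk, smul_comm]

theorem apply_mem_eigenspaceOver {H : Type*} [Group H] {f : H →* G} {V : Type*} [AddCommGroup V]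
    [Module ℂ V] {σ : Representation ℂ H V} {c : H} (hc : f c ∈ inertiaGroup χ) {w : V}
    (hw : w ∈ eigenspaceOver χ f σ) : σ c w ∈ eigenspaceOver χ f σ := by
  intro h hk
  have hk' : f (c⁻¹ * h * c) ∈ K := by
    rw [map_mul, map_mul, map_inv]
    simpa using ‹K.Normal›.conj_mem _ hk (f c)⁻¹
  have h1 : χ ⟨f (c⁻¹ * h * c), hk'⟩ = χ ⟨f h, hk⟩ := by
    rw [← inertiaGroup_apply_conj hc hk' (by simpa [mul_assoc] using hk)]
    congr 2
    simp [mul_assoc]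
  rw [← h1, ← map_smul, ← hw _ hk', ← Module.End.mul_apply, ← Module.End.mul_apply, ← map_mul,
    ← map_mul]
  congr 2
  group

/-- Since M fixes χ, the χ-eigenspace is stable under M, and irreducibility makes it the whole
space. -/
theorem IrrOver.apply_eq_smul [Finite G] {M : Subgroup (inertiaGroup χ)}
    (ρ : IrrOver χ (inclG M)) (m : M) (hm : inclG M m ∈ K) (v : ρ.rep) :
    ρ.rep.ρ m v = (χ ⟨inclG M m, hm⟩ : ℂ) • v := by
  obtain ⟨w, hw, h⟩ := ρ.exists_eigenvector
  have := ρ.irreducible.eq_top_of_mem (U := eigenspaceOver χ (inclG M) ρ.rep.ρ)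
    (fun g v hv => apply_mem_eigenspaceOver (g : inertiaGroup χ).2 hv) h hw
  have hv : v ∈ eigenspaceOver χ (inclG M) ρ.rep.ρ := this ▸ Submodule.mem_top
  exact hv m hm

/-- A normal subgroup `N` of the inertia group of `χ` that contains `K` and is abelian modulo the
kernel of `χ`. -/
structure IsAbelianOver (χ : K →* ℂˣ) (N : Subgroup (inertiaGroup χ)) : Prop where
  mem_of_mem : ∀ c : inertiaGroup χ, (c : G) ∈ K → c ∈ N
  commutator : ∀ a ∈ N, ∀ b ∈ N, ∃ h : ((a * b * a⁻¹ * b⁻¹ : inertiaGroup χ) : G) ∈ K,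
    χ ⟨_, h⟩ = 1

/-- `χ₁` is an extension of `χ`. -/
def Extends (χ : K →* ℂˣ) {N : Subgroup (inertiaGroup χ)} (χ₁ : N →* ℂˣ) : Prop :=
  ∀ (n : N) (h : inclG N n ∈ K), χ₁ n = χ ⟨inclG N n, h⟩

variable {N M : Subgroup (inertiaGroup χ)}

/-- Commutators of N act through χ, hence trivially. So N acts by commuting operators and has a
common eigenvector. -/
theorem IrrOver.exists_eigenvector_of_isAbelianOver [Finite G] (hN : IsAbelianOver χ N)
    (hNM : N ≤ M) (ρ : IrrOver χ (inclG M)) :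
    ∃ (χ₁ : N →* ℂˣ) (v : ρ.rep), Extends χ χ₁ ∧ v ≠ 0 ∧
      ∀ n, ρ.rep.ρ (Subgroup.inclusion hNM n) v = (χ₁ n : ℂ) • v := by
  have := ρ.irreducible.finiteDimensional
  have := ρ.irreducible.nontrivial
  obtain ⟨χ₁, v, hv, h⟩ := exists_eigenvector_of_commute
    (ρ.rep.ρ.comp (Subgroup.inclusion hNM)) fun a b => by
      obtain ⟨hk, h1⟩ := hN.commutator a a.2 b b.2
      let c : M := Subgroup.inclusion hNM (a * b * a⁻¹ * b⁻¹)
      have hc : ρ.rep.ρ c = 1 := by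
        ext v
        rw [ρ.apply_eq_smul c hk]
        change ((χ ⟨_, hk⟩ : ℂˣ) : ℂ) • v = v
        rw [h1, Units.val_one, one_smul]
      rw [← map_mul, ← map_mul]
      change ρ.rep.ρ (Subgroup.inclusion hNM (a * b)) = ρ.rep.ρ (Subgroup.inclusion hNM (b * a))
      have : a * b = (a * b * a⁻¹ * b⁻¹) * (b * a) := by group
      rw [this, map_mul, map_mul]
      change ρ.rep.ρ c * _ = _
      rw [hc, one_mul]
  refine ⟨χ₁, v, fun n hk => ?_, hv, h⟩
  have h1 := h n
  have h2 := ρ.apply_eq_smul (Subgroup.inclusion hNM n) hk v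
  have h3 : (χ₁ n : ℂ) • v = (χ ⟨inclG N n, hk⟩ : ℂ) • v := h1.symm.trans h2
  exact Units.ext (smul_left_injective ℂ hv h3)

/-- If `M` contains the stabilizer of every extension of `χ` to `N`, then every element of
`Irr(M | χ)` induces irreducibly. -/
theorem IrrOver.ind_isIrreducible [Finite G] [N.Normal] (hN : IsAbelianOver χ N)
    (hNM : N ≤ M) (hM : ∀ χ₁ : N →* ℂˣ, Extends χ χ₁ → inertiaGroup χ₁ ≤ M)
    (ρ : IrrOver χ (inclG M)) : (ρ.rep.ρ.ind (inclG M)).IsIrreducible := by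
  have := Fintype.ofFinite G
  have := Fintype.ofFinite M
  refine (indEquivCoind (inclG M) ρ.rep.ρ).symm.isIrreducible ?_
  obtain ⟨χ₁, v, hext, hv, h⟩ := ρ.exists_eigenvector_of_isAbelianOver hN hNM
  refine coind_isIrreducible_of_support (inclG_injective M) ρ.irreducible
    (Subgroup.inclusion hNM) (fun n => (χ₁ n : ℂ)) hv h fun f hf g hg => ?_
  -- The value f g transforms under K by χ on the right and by χ conjugated by g on the left. As it
  -- is nonzero, the two characters agree.
  have hgC : g ∈ inertiaGroup χ := by
    intro k
    have hkC : (k : G) ∈ inertiaGroup χ := le_inertiaGroup χ k.2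
    have hkC' : g * k * g⁻¹ ∈ inertiaGroup χ :=
      le_inertiaGroup χ (‹K.Normal›.conj_mem _ k.2 g)
    let n : N := ⟨⟨k, hkC⟩, hN.mem_of_mem _ k.2⟩
    let m : M := ⟨⟨g * k * g⁻¹, hkC'⟩, hNM (hN.mem_of_mem _ (‹K.Normal›.conj_mem _ k.2 g))⟩
    have h1 : f.1 (g * k) = (χ k : ℂ) • f.1 g := by
      have := hf n g
      rwa [hext n k.2] at this
    have h2 : f.1 (g * k) = (χ (MulAut.conjNormal g k) : ℂ) • f.1 g := by
      have e1 : g * k = inclG M m * g := by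
        change g * k = g * k * g⁻¹ * g
        group
      rw [e1, f.2 m g, ρ.apply_eq_smul m (‹K.Normal›.conj_mem _ k.2 g)]
      rfl
    exact Units.ext (smul_left_injective ℂ hg (h2.symm.trans h1))
  let c : inertiaGroup χ := ⟨g, hgC⟩
  -- The vector f g is an N-eigenvector in ρ for a conjugate of χ₁ by c. The characters of N in ρ
  -- form a single M-orbit, so c differs from an element of M by an element stabilizing χ₁.
  obtain ⟨m, hm⟩ := ρ.irreducible.exists_conj_of_eigenvector (Subgroup.inclusion hNM)
    (fun m => (MulAut.conjNormal (m : inertiaGroup χ)⁻¹ : MulAut N).toMonoidHom)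
    (fun m n => Subtype.ext (by simp)) (χ₁ := χ₁)
    (χ₂ := χ₁.comp (MulAut.conjNormal c⁻¹ : MulAut N).toMonoidHom) hv hg h (fun n => by
      have e1 : g * inclG M (Subgroup.inclusion hNM (MulAut.conjNormal c⁻¹ n)) =
          inclG M (Subgroup.inclusion hNM n) * g := by
        rw [inclG_apply, inclG_apply]
        simp [c, mul_assoc]
      have := hf (MulAut.conjNormal c⁻¹ n) g
      rw [e1, f.2] at this
      exact this)
  have hx : c⁻¹ * (m : inertiaGroup χ) ∈ inertiaGroup χ₁ := by
    intro n
    have := hm (MulAut.conjNormal (m : inertiaGroup χ) n)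
    simp only [MonoidHom.comp_apply, MulEquiv.coe_toMonoidHom, ← MulAut.mul_apply, ← map_mul,
      inv_mul_cancel, map_one, MulAut.one_apply] at this
    exact this
  have hcM : c ∈ M := by
    have := M.mul_mem m.2 (M.inv_mem (hM χ₁ hext hx))
    simpa using this
  exact ⟨⟨c, hcM⟩, rfl⟩

/-- Every element of `Irr(G | χ)` is induced from `M` if all elements of `Irr(M | χ)` induce
irreducibly. -/
theorem exists_equiv_ind [Finite G]
    (hind : ∀ ρ : IrrOver χ (inclG M), (ρ.rep.ρ.ind (inclG M)).IsIrreducible)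
    (δ : IrrOver χ (MonoidHom.id G)) :
    ∃ ρ : IrrOver χ (inclG M), Nonempty (δ.rep.ρ.Equiv (ρ.rep.ρ.ind (inclG M))) := by
  have := Fintype.ofFinite G
  have := Fintype.ofFinite M
  have hδ := δ.irreducible
  have := hδ.finiteDimensional
  obtain ⟨w, hw, hwk⟩ := δ.exists_eigenvector
  let U := eigenspaceOver χ (MonoidHom.id G) δ.rep.ρ
  obtain ⟨U', hU', hle, hirr⟩ := Representation.exists_isIrreducible_le
    (δ.rep.ρ.comp (inclG M)) U
    (fun m v hv => apply_mem_eigenspaceOver (f := MonoidHom.id G) (c := inclG M m)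
      (m : inertiaGroup χ).2 hv) (fun hb => hw ((Submodule.mem_bot ℂ).1 (hb ▸ hwk)))
  have := hirr.nontrivial
  obtain ⟨u, hu⟩ := exists_ne (0 : U')
  let ρ : IrrOver χ (inclG M) := ⟨Rep.of (restrictTo (δ.rep.ρ.comp (inclG M)) U' hU'), hirr,
    (constituent_iff_exists_eigenvector χ _ hirr).2 ⟨u, hu, fun m hm => Subtype.ext
      (hle u.2 (inclG M m) hm)⟩⟩
  refine ⟨ρ, ?_⟩
  have hρ := hind ρ
  let E := indEquivCoind (inclG M) ρ.rep.ρ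
  have hco : (coind (inclG M) ρ.rep.ρ).IsIrreducible := E.isIrreducible hρ
  -- The map given by Frobenius reciprocity. It is nonzero on the function at 1 with value u, so by
  -- Schur it is an isomorphism.
  let F : (coind (inclG M) ρ.rep.ρ).IntertwiningMap δ.rep.ρ :=
    ⟨∑ g : G, δ.rep.ρ g⁻¹ ∘ₗ U'.subtype ∘ₗ LinearMap.proj g ∘ₗ
        (coindV (inclG M) ρ.rep.ρ).subtype, fun a => by
      ext f
      simp only [LinearMap.comp_apply, LinearMap.sum_apply, map_sum]
      refine Fintype.sum_equiv (_root_.Equiv.mulRight a) _ _ fun g => ?_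
      change δ.rep.ρ g⁻¹ (U'.subtype (f.1 (g * a))) =
        δ.rep.ρ a (δ.rep.ρ (g * a)⁻¹ (U'.subtype (f.1 (g * a))))
      rw [← Module.End.mul_apply, ← map_mul, mul_inv_rev, mul_inv_cancel_left]⟩
  have hFapp : ∀ f, F f = ∑ g : G, δ.rep.ρ g⁻¹ (U'.subtype (f.1 g)) := by
    intro f
    change (∑ g : G, δ.rep.ρ g⁻¹ ∘ₗ U'.subtype ∘ₗ LinearMap.proj g ∘ₗ
        (coindV (inclG M) ρ.rep.ρ).subtype) f = _
    rw [LinearMap.sum_apply]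
    rfl
  have hF : F (coindSingle (inclG M) ρ.rep.ρ 1 u) = (Fintype.card M : ℂ) • (u : δ.rep) := by
    classical
    rw [hFapp]
    have h1 : ∀ g : G, δ.rep.ρ g⁻¹ (U'.subtype ((coindSingle (inclG M) ρ.rep.ρ 1 u).1 g)) =
        ∑ m : M, if inclG M m = g then (u : δ.rep) else 0 := by
      intro g
      rw [coindSingle_apply, map_sum, map_sum]
      refine Finset.sum_congr rfl fun m _ => ?_
      rw [mul_one]
      split_ifs with hmg
      · subst hmg
        change δ.rep.ρ (inclG M m)⁻¹ (δ.rep.ρ (inclG M m) u) = u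
        rw [← Module.End.mul_apply, ← map_mul, inv_mul_cancel, map_one, Module.End.one_apply]
      · rw [map_zero, map_zero]
    rw [Finset.sum_congr rfl fun g _ => h1 g, Finset.sum_comm, Finset.sum_congr rfl fun m _ =>
      Finset.sum_ite_eq Finset.univ (inclG M m) fun _ => (u : δ.rep)]
    simp [Nat.cast_smul_eq_nsmul]
  have hbij : Function.Bijective F := by
    refine (IsIrreducible.bijective_or_eq_zero F).resolve_right fun h0 => ?_
    rw [h0] at hF
    have h2 : (Fintype.card M : ℂ) • (u : δ.rep) = 0 := hF.symm
    exact hu (Subtype.ext ((smul_eq_zero.1 h2).resolve_left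
      (Nat.cast_ne_zero.2 Fintype.card_ne_zero)))
  exact ⟨((F.ofBijective hbij).symm).trans E.symm⟩

end CliffordTheory

/-! ### Dimensions, the bijection by induction, and maximality. -/

section CliffordTheory

open Representation

variable {G : Type*} [Group G] {K : Subgroup G} [K.Normal] {χ : K →* ℂˣ}
  {N M : Subgroup (inertiaGroup χ)}

theorem IrrOver.finrank_eq_one [Finite G] (hM : IsAbelianOver χ M) (ρ : IrrOver χ (inclG M)) :
    Module.finrank ℂ ρ.rep = 1 := by
  obtain ⟨χ₁, v, -, hv, h⟩ := ρ.exists_eigenvector_of_isAbelianOver hM le_rfl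
  refine finrank_eq_one_iff'.2 ⟨v, hv, fun w => ?_⟩
  have hw : w ∈ Submodule.span ℂ (Set.range fun g => ρ.rep.ρ g v) :=
    ρ.irreducible.span_orbit_eq_top hv ▸ Submodule.mem_top
  have hle : Submodule.span ℂ (Set.range fun g => ρ.rep.ρ g v) ≤ Submodule.span ℂ {v} := by
    rw [Submodule.span_le]
    rintro _ ⟨m, rfl⟩
    exact Submodule.mem_span_singleton.2 ⟨_, (h m).symm⟩
  exact Submodule.mem_span_singleton.1 (hle hw)

/-- An N-eigenvector v and its translate by e span a subspace containing the whole orbit, because N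
has at most the two cosets N and N e in M. -/
theorem IrrOver.finrank_eq_one_or_two [Finite G] [N.Normal] (hN : IsAbelianOver χ N)
    (hNM : N ≤ M) {e : inertiaGroup χ} (he : e ∈ M)
    (hM : ∀ m ∈ M, m ∈ N ∨ m * e⁻¹ ∈ N) (ρ : IrrOver χ (inclG M)) :
    Module.finrank ℂ ρ.rep = 1 ∨ Module.finrank ℂ ρ.rep = 2 := by
  classical
  obtain ⟨χ₁, v, -, hv, h⟩ := ρ.exists_eigenvector_of_isAbelianOver hN hNM
  have hfd := ρ.irreducible.finiteDimensional
  have hnt := ρ.irreducible.nontrivial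
  let e' : M := ⟨e, he⟩
  have hle : Submodule.span ℂ (Set.range fun g => ρ.rep.ρ g v) ≤
      Submodule.span ℂ (({v, ρ.rep.ρ e' v} : Finset ρ.rep) : Set ρ.rep) := by
    rw [Submodule.span_le]
    rintro _ ⟨m, rfl⟩
    rcases hM m m.2 with hm | hm
    · have := h ⟨m, hm⟩
      change ρ.rep.ρ m v = _ at this
      change ρ.rep.ρ m v ∈ _
      rw [this]
      exact Submodule.smul_mem _ _ (Submodule.subset_span (by simp))
    · have hm' : e⁻¹ * (m * e⁻¹) * e ∈ N := by
        simpa using ‹N.Normal›.conj_mem _ hm e⁻¹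
      have := h ⟨_, hm'⟩
      have h2 : m = e' * Subgroup.inclusion hNM ⟨_, hm'⟩ := Subtype.ext (by
        change (m : inertiaGroup χ) = e * (e⁻¹ * (m * e⁻¹) * e)
        group)
      change ρ.rep.ρ m v ∈ _
      rw [h2, map_mul, Module.End.mul_apply, this, map_smul]
      exact Submodule.smul_mem _ _ (Submodule.subset_span (by simp))
  have h2 : Module.finrank ℂ ρ.rep ≤ 2 := by
    rw [← finrank_top, ← ρ.irreducible.span_orbit_eq_top hv]
    exact ((Submodule.finrank_mono hle).trans (finrank_span_finset_le_card _)).trans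
      Finset.card_le_two
  have h1 : 0 < Module.finrank ℂ ρ.rep := Module.finrank_pos
  omega

theorem exists_irrOver_equiv_ind [Finite G]
    (hM : ∀ c : inertiaGroup χ, (c : G) ∈ K → c ∈ M) (ρ : IrrOver χ (inclG M))
    (hρ : (ρ.rep.ρ.ind (inclG M)).IsIrreducible) :
    ∃ δ : IrrOver χ (MonoidHom.id G), Nonempty (δ.rep.ρ.Equiv (ρ.rep.ρ.ind (inclG M))) := by
  have := Fintype.ofFinite G
  have := Fintype.ofFinite M
  let E := indEquivCoind (inclG M) ρ.rep.ρ
  have := ρ.irreducible.nontrivial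
  obtain ⟨v, hv⟩ := exists_ne (0 : ρ.rep)
  have h1 : (coindSingle (inclG M) ρ.rep.ρ 1 v).1 1 = v := by
    simpa using coindSingle_apply_map ρ.rep.ρ (inclG_injective M) 1 v
  obtain ⟨δ, ⟨e⟩⟩ := exists_irrOver χ (MonoidHom.id G) (E.isIrreducible hρ)
    (w := coindSingle (inclG M) ρ.rep.ρ 1 v) (fun h0 => hv (by rw [← h1, h0]; rfl)) fun k hk => by
      let m : M := ⟨⟨k, le_inertiaGroup χ hk⟩, hM _ hk⟩
      have := coindSingle_map_mul (inclG M) ρ.rep.ρ m (1 * k⁻¹) v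
      rw [coind_coindSingle, ← this, ρ.apply_eq_smul m hk, map_smul]
      have e1 : inclG M m * (1 * k⁻¹) = 1 := by
        change k * (1 * k⁻¹) = 1
        group
      rw [e1]
      rfl
  exact ⟨δ, ⟨e.trans E.symm⟩⟩

/-- Left translation by c⁻¹ followed by T maps equivariant functions to equivariant functions. -/
theorem IsConjRep.nonempty_equiv_ind [Finite G] [M.Normal] {ρ₁ ρ₂ : IrrOver χ (inclG M)}
    (h₁ : (ρ₁.rep.ρ.ind (inclG M)).IsIrreducible) (h₂ : (ρ₂.rep.ρ.ind (inclG M)).IsIrreducible)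
    (h : IsConjRep ρ₁.rep.ρ ρ₂.rep.ρ) :
    Nonempty ((ρ₁.rep.ρ.ind (inclG M)).Equiv (ρ₂.rep.ρ.ind (inclG M))) := by
  have := Fintype.ofFinite G
  have := Fintype.ofFinite M
  obtain ⟨c, T, hT⟩ := h
  let E₁ := indEquivCoind (inclG M) ρ₁.rep.ρ
  let E₂ := indEquivCoind (inclG M) ρ₂.rep.ρ
  have h₁' := E₁.isIrreducible h₁
  have h₂' := E₂.isIrreducible h₂
  have hT' : ∀ (f : coindV (inclG M) ρ₁.rep.ρ) (m : M) (g : G),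
      T (f.1 ((c : G)⁻¹ * (inclG M m * g))) = ρ₂.rep.ρ m (T (f.1 ((c : G)⁻¹ * g))) := by
    intro f m g
    have e1 : (c : G)⁻¹ * (inclG M m * g) = inclG M (MulAut.conjNormal c⁻¹ m) * ((c : G)⁻¹ * g) := by
      rw [inclG_apply, inclG_apply]
      simp [mul_assoc]
    rw [e1, f.2, hT, ← MulAut.mul_apply, ← map_mul, mul_inv_cancel, map_one, MulAut.one_apply]
  let F : (coind (inclG M) ρ₁.rep.ρ).IntertwiningMap (coind (inclG M) ρ₂.rep.ρ) :=
    ⟨{ toFun := fun f => ⟨fun g => T (f.1 ((c : G)⁻¹ * g)), fun m g => hT' f m g⟩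
       map_add' := fun a b => by ext; simp
       map_smul' := fun a b => by ext; simp }, fun g => by
      ext f x
      change T (f.1 ((c : G)⁻¹ * x * g)) = T (f.1 ((c : G)⁻¹ * (x * g)))
      rw [mul_assoc]⟩
  have hF : Function.Bijective F := by
    refine (IsIrreducible.bijective_or_eq_zero F).resolve_right fun h0 => ?_
    have := h₁'.nontrivial
    obtain ⟨f, hf⟩ := exists_ne (0 : coindV (inclG M) ρ₁.rep.ρ)
    refine hf (Subtype.ext (funext fun g => ?_))
    have h1 : (F f).1 (c * g) = 0 := by rw [h0]; rfl
    have h2 : T (f.1 ((c : G)⁻¹ * (c * g))) = 0 := h1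
    rw [inv_mul_cancel_left] at h2
    exact T.map_eq_zero_iff.1 h2
  exact ⟨(E₁.trans (F.ofBijective hF)).trans E₂.symm⟩

/-- Evaluation at a point g where some image function is nonzero intertwines ρ₁ with a conjugate of
ρ₂. Comparing the two actions of K shows that g stabilizes χ, and Schur's argument makes the
evaluation bijective. -/
theorem isConjRep_of_equiv_ind [Finite G] [M.Normal] (hM : ∀ c : inertiaGroup χ, (c : G) ∈ K → c ∈ M)
    {ρ₁ ρ₂ : IrrOver χ (inclG M)}
    (e : (ρ₁.rep.ρ.ind (inclG M)).Equiv (ρ₂.rep.ρ.ind (inclG M))) :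
    IsConjRep ρ₁.rep.ρ ρ₂.rep.ρ := by
  have := Fintype.ofFinite G
  have := Fintype.ofFinite M
  let E₁ := indEquivCoind (inclG M) ρ₁.rep.ρ
  let E₂ := indEquivCoind (inclG M) ρ₂.rep.ρ
  obtain ⟨E, hE⟩ := ((E₁.symm.trans e).trans E₂).exists_linearEquiv
  let F : ρ₁.rep →ₗ[ℂ] coindV (inclG M) ρ₂.rep.ρ :=
    E.toLinearMap ∘ₗ coindSingle (inclG M) ρ₁.rep.ρ 1
  have hF : ∀ (m : M) v g, (F (ρ₁.rep.ρ m v)).1 g = (F v).1 (g * inclG M m) := by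
    intro m v g
    rw [← coind_apply_apply]
    change (E _).1 g = (coind _ _ _ (E _)).1 g
    rw [← hE, coind_coindSingle, ← coindSingle_map_mul (inclG M) ρ₁.rep.ρ m
      (1 * (inclG M m)⁻¹) v, one_mul, mul_inv_cancel]
  have := ρ₁.irreducible.nontrivial
  obtain ⟨v, hv⟩ := exists_ne (0 : ρ₁.rep)
  have hFv : F v ≠ 0 := by
    intro h0
    have h1 : coindSingle (inclG M) ρ₁.rep.ρ 1 v = 0 := E.map_eq_zero_iff.1 h0
    have h2 : (coindSingle (inclG M) ρ₁.rep.ρ 1 v).1 1 = v := by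
      simpa using coindSingle_apply_map ρ₁.rep.ρ (inclG_injective M) 1 v
    rw [h1] at h2
    exact hv h2.symm
  obtain ⟨g, hg⟩ : ∃ g, (F v).1 g ≠ 0 := by
    by_contra hcon
    push Not at hcon
    exact hFv (Subtype.ext (funext hcon))
  have hgC : g ∈ inertiaGroup χ := by
    intro k
    let m₁ : M := ⟨⟨k, le_inertiaGroup χ k.2⟩, hM _ k.2⟩
    let m₂ : M := ⟨⟨g * k * g⁻¹, le_inertiaGroup χ (‹K.Normal›.conj_mem _ k.2 g)⟩,
      hM _ (‹K.Normal›.conj_mem _ k.2 g)⟩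
    have h1 := hF m₁ v g
    rw [ρ₁.apply_eq_smul m₁ k.2, map_smul] at h1
    have e1 : g * inclG M m₁ = inclG M m₂ * g := by
      change g * k = g * k * g⁻¹ * g
      group
    rw [e1, (F v).2, ρ₂.apply_eq_smul m₂ (‹K.Normal›.conj_mem _ k.2 g)] at h1
    exact Units.ext (smul_left_injective ℂ hg h1.symm)
  let c : inertiaGroup χ := ⟨g, hgC⟩
  let T : ρ₁.rep →ₗ[ℂ] ρ₂.rep :=
    LinearMap.proj g ∘ₗ (coindV (inclG M) ρ₂.rep.ρ).subtype ∘ₗ F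
  have hT : ∀ (m : M) v, T (ρ₁.rep.ρ m v) = ρ₂.rep.ρ (MulAut.conjNormal c m) (T v) := by
    intro m v
    change (F (ρ₁.rep.ρ m v)).1 g = ρ₂.rep.ρ (MulAut.conjNormal c m) ((F v).1 g)
    rw [hF, ← (F v).2]
    rw [inclG_apply, inclG_apply]
    simp [c]
  have hinj : LinearMap.ker T = ⊥ := by
    refine (((isIrreducible_iff_forall_submodule _).1 ρ₁.irreducible).2 (LinearMap.ker T)
      fun m u hu => ?_).resolve_right fun ht => hg ?_
    · rw [LinearMap.mem_ker, hT, LinearMap.mem_ker.1 hu, map_zero]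
    · have : v ∈ LinearMap.ker T := ht ▸ Submodule.mem_top
      exact this
  have hsurj : LinearMap.range T = ⊤ := by
    refine ρ₂.irreducible.eq_top_of_mem (fun m u hu => ?_) (v := T v) ⟨v, rfl⟩ hg
    obtain ⟨u, rfl⟩ := hu
    refine ⟨ρ₁.rep.ρ (MulAut.conjNormal c⁻¹ m) u, ?_⟩
    rw [hT, ← MulAut.mul_apply, ← map_mul, mul_inv_cancel, map_one, MulAut.one_apply]
  exact ⟨c, LinearEquiv.ofBijective T ⟨LinearMap.ker_eq_bot.1 hinj, LinearMap.range_eq_top.1 hsurj⟩,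
    hT⟩

theorem inductionBijective_of_ind_isIrreducible [Finite G] [M.Normal]
    (hM : ∀ c : inertiaGroup χ, (c : G) ∈ K → c ∈ M)
    (hind : ∀ ρ : IrrOver χ (inclG M), (ρ.rep.ρ.ind (inclG M)).IsIrreducible) :
    InductionBijective χ M := by
  choose δ hδ using fun ρ : IrrOver χ (inclG M) => exists_irrOver_equiv_ind hM ρ (hind ρ)
  have hwd : ∀ ρ₁ ρ₂ : IrrOver χ (inclG M), conjSetoid χ M ρ₁ ρ₂ →
      (Quotient.mk (isoSetoid χ (MonoidHom.id G)) (δ ρ₁)) = Quotient.mk _ (δ ρ₂) := by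
    intro ρ₁ ρ₂ h
    obtain ⟨e⟩ := IsConjRep.nonempty_equiv_ind (hind ρ₁) (hind ρ₂) h
    obtain ⟨e₁⟩ := hδ ρ₁
    obtain ⟨e₂⟩ := hδ ρ₂
    exact Quotient.sound ⟨(e₁.trans e).trans e₂.symm⟩
  let Φ : Quotient (conjSetoid χ M) → Quotient (isoSetoid χ (MonoidHom.id G)) :=
    Quotient.lift (fun ρ => Quotient.mk _ (δ ρ)) hwd
  have hΦ : Function.Bijective Φ := by
    constructor
    · rintro ⟨ρ₁⟩ ⟨ρ₂⟩ h
      obtain ⟨e⟩ := Quotient.exact h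
      obtain ⟨e₁⟩ := hδ ρ₁
      obtain ⟨e₂⟩ := hδ ρ₂
      exact Quotient.sound (isConjRep_of_equiv_ind hM ((e₁.symm.trans e).trans e₂))
    · rintro ⟨d⟩
      obtain ⟨ρ, ⟨e⟩⟩ := exists_equiv_ind hind d
      obtain ⟨e₁⟩ := hδ ρ
      exact ⟨Quotient.mk _ ρ, Quotient.sound ⟨e₁.trans e.symm⟩⟩
  refine ⟨Equiv.ofBijective Φ hΦ, fun ρ d => ?_⟩
  obtain ⟨e₁⟩ := hδ ρ
  constructor
  · intro h
    obtain ⟨e⟩ := Quotient.exact h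
    exact ⟨e.symm.trans e₁⟩
  · rintro ⟨e⟩
    exact Quotient.sound ⟨e₁.trans e.symm⟩

/-- If `χ` extends to `M ≥ M'` and all of `Irr(M' | χ)` induces irreducibly, then `M = M'`. -/
theorem le_of_extends_of_ind_isIrreducible [Finite G] {M' : Subgroup (inertiaGroup χ)} [M'.Normal]
    (hM' : M' ≤ M) {χ' : M →* ℂˣ} (hχ' : Extends χ χ')
    (hind : ∀ ρ : IrrOver χ (inclG M'), (ρ.rep.ρ.ind (inclG M')).IsIrreducible) : M ≤ M' := by
  have := Fintype.ofFinite G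
  have := Fintype.ofFinite M'
  intro c hc
  let θ : M' →* ℂˣ := χ'.comp (Subgroup.inclusion hM')
  have hirr : (charRep θ).IsIrreducible := by
    rw [isIrreducible_iff_forall_submodule]
    exact ⟨inferInstance, fun U _ => eq_bot_or_eq_top U⟩
  let ρ : IrrOver χ (inclG M') := ⟨Rep.of (charRep θ), hirr,
    (constituent_iff_exists_eigenvector χ _ hirr).2 ⟨1, one_ne_zero, fun m hm => by
      have h1 : θ m = χ ⟨inclG M' m, hm⟩ := hχ' (Subgroup.inclusion hM' m) hm
      rw [charRep_apply, h1, smul_eq_mul]⟩⟩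
  let E := indEquivCoind (inclG M') (charRep θ)
  have hco : (coind (inclG M') (charRep θ)).IsIrreducible := E.isIrreducible (hind ρ)
  have := hco.finiteDimensional
  have hL : ∀ (f : coindV (inclG M') (charRep θ)) (m : M') (g : G),
      f.1 ((c : G) * (inclG M' m * g)) = charRep θ m (f.1 ((c : G) * g)) := by
    intro f m g
    have e1 : (c : G) * (inclG M' m * g) = inclG M' (MulAut.conjNormal c m) * ((c : G) * g) := by
      rw [inclG_apply, inclG_apply]
      simp [mul_assoc]
    have e2 : θ (MulAut.conjNormal c m) = θ m := by
      have : Subgroup.inclusion hM' (MulAut.conjNormal c m) =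
          (⟨c, hc⟩ : M) * Subgroup.inclusion hM' m * (⟨c, hc⟩ : M)⁻¹ := Subtype.ext (by simp)
      change χ' (Subgroup.inclusion hM' (MulAut.conjNormal c m)) = _
      rw [this, map_mul, map_mul, map_inv, mul_comm, inv_mul_cancel_left]
      rfl
    rw [e1, f.2, charRep_apply, charRep_apply, e2]
  -- θ extends to M, so it is invariant under c and left translation by c is an endomorphism. By
  -- Schur it is a scalar, but it carries a function supported on M' to one supported on c⁻¹M'; so c
  -- lies in M'.
  let F : (coind (inclG M') (charRep θ)).IntertwiningMap (coind (inclG M') (charRep θ)) :=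
    ⟨{ toFun := fun f => ⟨fun g => f.1 ((c : G) * g), fun m g => hL f m g⟩
       map_add' := fun a b => by ext; simp
       map_smul' := fun a b => by ext; simp }, fun g => by
      ext f x
      change f.1 ((c : G) * x * g) = f.1 ((c : G) * (x * g))
      rw [mul_assoc]⟩
  obtain ⟨z, hz⟩ := (IsIrreducible.algebraMap_intertwiningMap_bijective_of_isAlgClosed
    (ρ := coind (inclG M') (charRep θ))).2 F
  let f := coindSingle (inclG M') (charRep θ) 1 1
  have h1 : (F f).1 (c : G)⁻¹ = 1 := by
    change f.1 ((c : G) * (c : G)⁻¹) = 1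
    rw [mul_inv_cancel]
    simpa using coindSingle_apply_map (charRep θ) (inclG_injective M') 1 1
  have h2 : (F f).1 (c : G)⁻¹ = z * f.1 (c : G)⁻¹ := by
    rw [← hz]
    rfl
  have h3 : (c : G)⁻¹ ∈ (inclG M').range := by
    by_contra h
    rw [h2, coindSingle_apply_of_notMem _ _ h, mul_zero] at h1
    exact zero_ne_one h1
  obtain ⟨m, hm⟩ := h3
  have h4 : c⁻¹ = m := Subtype.ext hm.symm
  exact inv_mem_iff.1 (h4 ▸ m.2)

end CliffordTheory

/-! ### Extending characters to their stabilizers. -/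

section CliffordTheory

open Representation

/-- A linear character of a subgroup that is trivial on all commutators of the group extends. -/
theorem exists_extension_of_commutator {Γ : Type*} [Group Γ] [Finite Γ] {N : Subgroup Γ}
    (θ : N →* ℂˣ) (hcomm : ∀ a b : Γ, ∃ h : a * b * a⁻¹ * b⁻¹ ∈ N, θ ⟨_, h⟩ = 1) :
    ∃ θ' : Γ →* ℂˣ, ∀ n : N, θ' n = θ n := by
  let p : N →* N.map Abelianization.of := (Abelianization.of).subgroupMap N
  have hp : Function.Surjective p := MonoidHom.subgroupMap_surjective _ _
  -- θ factors through the image of N in the finite abelian group Γ/[Γ, Γ], where characters of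
  -- subgroups extend.
  have hle : commutator Γ ≤ θ.ker.map N.subtype := by
    rw [commutator_def, Subgroup.commutator_le]
    intro a _ b _
    obtain ⟨h, h1⟩ := hcomm a b
    exact ⟨⟨_, h⟩, h1, rfl⟩
  have hker : p.ker ≤ θ.ker := by
    intro n hn
    have h1 : Abelianization.of (n : Γ) = 1 := congrArg Subtype.val hn
    rw [← MonoidHom.mem_ker, Abelianization.ker_of] at h1
    obtain ⟨n', hn', he⟩ := hle h1
    have : n' = n := Subtype.ext he
    exact this ▸ hn'
  let θ₁ : N.map Abelianization.of →* ℂˣ := MonoidHom.liftOfSurjective p hp ⟨θ, hker⟩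
  have hθ₁ : ∀ n, θ₁ (p n) = θ n := fun n =>
    MonoidHom.liftOfRightInverse_comp_apply p _ (Function.rightInverse_surjInv hp) ⟨θ, hker⟩ n
  have : Finite (Abelianization Γ) := Quotient.finite _
  obtain ⟨θ₂, hθ₂⟩ := MonoidHom.domRestrict_surjective ℂ (N.map Abelianization.of) θ₁
  refine ⟨θ₂.comp Abelianization.of, fun n => ?_⟩
  rw [← hθ₁, ← hθ₂]
  rfl

variable {G : Type*} [Group G] {K : Subgroup G} [K.Normal] {χ : K →* ℂˣ}
  {N M : Subgroup (inertiaGroup χ)}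

theorem IsAbelianOver.exists_extends [Finite G] (hN : IsAbelianOver χ N) :
    ∃ χ₁ : N →* ℂˣ, Extends χ χ₁ := by
  obtain ⟨θ, hθ⟩ := exists_extension_of_commutator
    (χ.comp ((inclG N).subgroupComap K)) fun a b => by
      obtain ⟨h, h1⟩ := hN.commutator a a.2 b b.2
      exact ⟨h, h1⟩
  exact ⟨θ, fun n h => hθ ⟨n, h⟩⟩

/-- The data controlling the stabilizers of the extensions of `χ` to `N`: a set `E` of commuting
representatives of the cosets of `N` in the inertia group. -/
structure IsTransversalOver (χ : K →* ℂˣ) (N : Subgroup (inertiaGroup χ))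
    (E : Set (inertiaGroup χ)) : Prop where
  exists_mul : ∀ c, ∃ n ∈ N, ∃ e ∈ E, c = n * e
  comm : ∀ e ∈ E, ∀ e' ∈ E, e * e' = e' * e
  sq_mem : ∀ e ∈ E, ((e * e : inertiaGroup χ) : G) ∈ K

/-- `χ` is trivial on all the commutators of `e` with elements of `N` that lie in `K`. -/
def IsTrivialOnCommutators (χ : K →* ℂˣ) (N : Subgroup (inertiaGroup χ)) (e : inertiaGroup χ) :
    Prop :=
  ∀ n ∈ N, ∀ h : ((e * n * e⁻¹ * n⁻¹ : inertiaGroup χ) : G) ∈ K, χ ⟨_, h⟩ = 1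

theorem Extends.apply_commutator [N.Normal] {χ₁ : N →* ℂˣ} {e : inertiaGroup χ}
    (he : e ∈ inertiaGroup χ₁) {n : inertiaGroup χ} (hn : n ∈ N)
    (h : e * n * e⁻¹ * n⁻¹ ∈ N) : χ₁ ⟨_, h⟩ = 1 := by
  have h1 : (⟨_, h⟩ : N) = MulAut.conjNormal e ⟨n, hn⟩ * (⟨n, hn⟩ : N)⁻¹ := Subtype.ext rfl
  rw [h1, map_mul, he, map_inv, mul_inv_cancel]

/-- This removes the chosen extension: what remains is a condition on e and χ alone, so elements of
stabilizers of different extensions can be compared. -/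
theorem Extends.isTrivialOnCommutators [N.Normal] {χ₁ : N →* ℂˣ}
    (hext : Extends χ χ₁) (hN : IsAbelianOver χ N) {e : inertiaGroup χ}
    (he : e ∈ inertiaGroup χ₁) : IsTrivialOnCommutators χ N e := fun _ hn h =>
  (hext ⟨_, hN.mem_of_mem _ h⟩ h).symm.trans (Extends.apply_commutator he hn _)

namespace IsTransversalOver

variable {E : Set (inertiaGroup χ)} (hE : IsTransversalOver χ N E)

include hE

theorem commutator_mem [N.Normal] (a b : inertiaGroup χ) : a * b * a⁻¹ * b⁻¹ ∈ N := by
  obtain ⟨n, hn, e, he, rfl⟩ := hE.exists_mul a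
  obtain ⟨n', hn', e', he', rfl⟩ := hE.exists_mul b
  rw [← QuotientGroup.eq_one_iff]
  have h1 : ((n : inertiaGroup χ) : inertiaGroup χ ⧸ N) = 1 := (QuotientGroup.eq_one_iff n).2 hn
  have h2 : ((n' : inertiaGroup χ) : inertiaGroup χ ⧸ N) = 1 := (QuotientGroup.eq_one_iff n').2 hn'
  have h3 : (e : inertiaGroup χ ⧸ N) * e' = e' * e := by
    rw [← QuotientGroup.mk_mul, hE.comm e he e' he', QuotientGroup.mk_mul]
  simp only [QuotientGroup.mk_mul, QuotientGroup.mk_inv, h1, h2, one_mul]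
  rw [h3]
  group

theorem normal [N.Normal] (hNM : N ≤ M) : M.Normal := by
  refine ⟨fun m hm c => ?_⟩
  have := M.mul_mem (hNM (hE.commutator_mem c m)) hm
  simpa using this

/-- As e and e' commute, the commutator of n e and n' e' is a product of n, n' and inverses of their
conjugates up to order. The invariance of χ₁ under e and e' makes the values cancel. -/
theorem apply_commutator_eq_one [N.Normal] {χ₁ : N →* ℂˣ} {a b : inertiaGroup χ}
    (ha : a ∈ inertiaGroup χ₁) (hb : b ∈ inertiaGroup χ₁) :
    χ₁ ⟨_, hE.commutator_mem a b⟩ = 1 := by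
  obtain ⟨n, hn, e, he, rfl⟩ := hE.exists_mul a
  obtain ⟨n', hn', e', he', rfl⟩ := hE.exists_mul b
  have hle := le_inertiaGroup χ₁
  have he1 : e ∈ inertiaGroup χ₁ := by
    simpa using Subgroup.mul_mem _ (Subgroup.inv_mem _ (hle hn)) ha
  have he1' : e' ∈ inertiaGroup χ₁ := by
    simpa using Subgroup.mul_mem _ (Subgroup.inv_mem _ (hle hn')) hb
  have key : (⟨_, hE.commutator_mem (n * e) (n' * e')⟩ : N) =
      ⟨n, hn⟩ * MulAut.conjNormal e ⟨n', hn'⟩ * (MulAut.conjNormal e' ⟨n, hn⟩)⁻¹ *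
        (⟨n', hn'⟩ : N)⁻¹ := by
    refine Subtype.ext ?_
    change n * e * (n' * e') * (n * e)⁻¹ * (n' * e')⁻¹ =
      n * (e * n' * e⁻¹) * (e' * n * e'⁻¹)⁻¹ * n'⁻¹
    have h1 : n * e * (n' * e') * (n * e)⁻¹ * (n' * e')⁻¹ =
      n * (e * n' * e⁻¹) * ((e * e') * (e' * e)⁻¹) * (e' * n * e'⁻¹)⁻¹ * n'⁻¹ := by group
    rw [h1, hE.comm e he e' he', mul_inv_cancel, mul_one]
  rw [key, map_mul, map_mul, map_mul, map_inv, map_inv, he1, he1', mul_comm (χ₁ ⟨n, hn⟩),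
    mul_inv_cancel_right, mul_inv_cancel]

theorem exists_extends_inertiaGroup [Finite G] [N.Normal] {χ₁ : N →* ℂˣ}
    (hN : IsAbelianOver χ N) (hext : Extends χ χ₁) :
    ∃ χ' : inertiaGroup χ₁ →* ℂˣ, Extends χ χ' := by
  obtain ⟨θ, hθ⟩ := exists_extension_of_commutator
    (χ₁.comp ((inertiaGroup χ₁).subtype.subgroupComap N)) fun a b =>
      ⟨hE.commutator_mem a b, hE.apply_commutator_eq_one a.2 b.2⟩
  refine ⟨θ, fun n h => ?_⟩
  exact (hθ ⟨n, hN.mem_of_mem _ h⟩).trans (hext _ h)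

/-- If all commutators of the stabilizers of extensions of `χ` with `N` lie in `K`, then all these
stabilizers agree and are abelian over `χ`. -/
theorem isAbelianOver_inertiaGroup [N.Normal] (hN : IsAbelianOver χ N) {χ₁ : N →* ℂˣ}
    (hext : Extends χ χ₁)
    (h : ∀ g ∈ inertiaGroup χ₁, ∀ n ∈ N, ((g * n * g⁻¹ * n⁻¹ : inertiaGroup χ) : G) ∈ K) :
    IsAbelianOver χ (inertiaGroup χ₁) := by
  have hle := le_inertiaGroup χ₁
  refine ⟨fun c hc => hle (hN.mem_of_mem c hc), fun a ha b hb => ?_⟩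
  have hmem : ((a * b * a⁻¹ * b⁻¹ : inertiaGroup χ) : G) ∈ K := by
    obtain ⟨n, hn, e, he, rfl⟩ := hE.exists_mul a
    obtain ⟨n', hn', e', he', rfl⟩ := hE.exists_mul b
    have he1 : e ∈ inertiaGroup χ₁ := by
      simpa using Subgroup.mul_mem _ (Subgroup.inv_mem _ (hle hn)) ha
    have he1' : e' ∈ inertiaGroup χ₁ := by
      simpa using Subgroup.mul_mem _ (Subgroup.inv_mem _ (hle hn')) hb
    let q : inertiaGroup χ →* G ⧸ K := (QuotientGroup.mk' K).comp (inertiaGroup χ).subtype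
    have hq : ∀ c : inertiaGroup χ, (c : G) ∈ K ↔ q c = 1 := fun c =>
      (QuotientGroup.eq_one_iff _).symm
    have hc : ∀ x y : inertiaGroup χ, ((x * y * x⁻¹ * y⁻¹ : inertiaGroup χ) : G) ∈ K →
        Commute (q x) (q y) := by
      intro x y hxy
      rw [hq, map_mul, map_mul, map_mul, map_inv, map_inv] at hxy
      have h1 := mul_inv_eq_one.1 hxy
      exact mul_inv_eq_iff_eq_mul.1 h1
    rw [hq]
    have c1 : Commute (q n) (q n') := hc _ _ (hN.commutator n hn n' hn').1
    have c2 : Commute (q e) (q n') := hc _ _ (h e he1 n' hn')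
    have c3 : Commute (q e') (q n) := hc _ _ (h e' he1' n hn)
    have c4 : Commute (q e) (q e') := by
      change q e * q e' = q e' * q e
      rw [← map_mul, hE.comm e he e' he', map_mul]
    have : Commute (q (n * e)) (q (n' * e')) := by
      rw [map_mul, map_mul]
      exact (c1.mul_right c3.symm).mul_left (c2.mul_right c4)
    rw [map_mul, map_mul, map_mul, map_inv, map_inv, this.eq, mul_assoc, mul_assoc,
      mul_inv_cancel_left, mul_inv_cancel]
  exact ⟨hmem, (hext ⟨_, hE.commutator_mem a b⟩ hmem).symm.trans
    (hE.apply_commutator_eq_one ha hb)⟩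

end IsTransversalOver

end CliffordTheory

/-! ### Existence and uniqueness from an abelian layer with commuting coset representatives. -/

section CliffordTheory

open Representation

variable {G : Type*} [Group G] {K : Subgroup G} [K.Normal] {χ : K →* ℂˣ}
  {N M : Subgroup (inertiaGroup χ)}

/-- A normal subgroup to which `χ` extends lies in the stabilizer of an extension of `χ` to any
subgroup `N` of it. -/
theorem le_inertiaGroup_comp_inclusion [N.Normal] (hNM : N ≤ M) (χ' : M →* ℂˣ) :
    M ≤ inertiaGroup (χ'.comp (Subgroup.inclusion hNM)) := by
  intro m hm n
  have h1 : Subgroup.inclusion hNM (MulAut.conjNormal m n) =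
      ⟨m, hm⟩ * Subgroup.inclusion hNM n * (⟨m, hm⟩ : M)⁻¹ := Subtype.ext rfl
  rw [MonoidHom.comp_apply, h1, map_mul, map_mul, map_inv, mul_comm, inv_mul_cancel_left]
  rfl

/-- A normal subgroup `M` of the inertia group that contains the stabilizers of all the extensions
of `χ` to `N`, and to which `χ` extends, is the only candidate for a Clifford subgroup. -/
theorem IsCliffordSubgroup.eq [Finite G] [N.Normal] {C : Subgroup G}
    (hC : C.subgroupOf (inertiaGroup χ) = N)
    (hM : ∀ χ₁ : N →* ℂˣ, Extends χ χ₁ → inertiaGroup χ₁ ≤ M)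
    {χ' : M →* ℂˣ} (hχ' : Extends χ χ') {M' : Subgroup (inertiaGroup χ)}
    (hM' : IsCliffordSubgroup C χ M') : M' = M := by
  have := hM'.normal
  have hNM' : N ≤ M' := by
    rintro n hn
    rw [← hC] at hn
    obtain ⟨m, hm, he⟩ := hM'.le hn
    exact Subtype.ext he ▸ hm
  obtain ⟨θ, hθ⟩ := hM'.extends_char
  -- An extension of χ to M' restricts to an M'-invariant extension on N, so M' lies in its
  -- stabilizer.
  have hle : M' ≤ M := (le_inertiaGroup_comp_inclusion hNM' θ).trans
    (hM _ fun n h => hθ (Subgroup.inclusion hNM' n) h)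
  exact le_antisymm hle (le_of_extends_of_ind_isIrreducible hle hχ' hM'.ind_irreducible)

theorem isCliffordSubgroup_of_inertiaGroup_le [Finite G] [N.Normal] [M.Normal] {C : Subgroup G}
    (hCχ : C ≤ inertiaGroup χ) (hC : C.subgroupOf (inertiaGroup χ) = N)
    (hN : IsAbelianOver χ N) (hNM : N ≤ M)
    (hM : ∀ χ₁ : N →* ℂˣ, Extends χ χ₁ → inertiaGroup χ₁ ≤ M)
    (hχ' : ∃ χ' : M →* ℂˣ, Extends χ χ')
    (hquot : (∀ x y : M ⧸ K.comap (inclG M), x * y = y * x) ∨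
      ∃ B D : Subgroup (M ⧸ K.comap (inclG M)),
        B.Normal ∧ (∀ x ∈ B, ∀ y ∈ B, x * y = y * x) ∧ Nat.card D = 2 ∧ B.IsComplement' D)
    (hdim : ∀ ρ : IrrOver χ (inclG M),
      Module.finrank ℂ ρ.rep = 1 ∨ Module.finrank ℂ ρ.rep = 2) :
    IsCliffordSubgroup C χ M where
  normal := inferInstance
  le c hc := by
    refine ⟨⟨c, hCχ hc⟩, hNM ?_, rfl⟩
    rw [← hC]
    exact hc
  extends_char := hχ'
  ind_irreducible := IrrOver.ind_isIrreducible hN hNM hM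
  ind_surjective := exists_equiv_ind (IrrOver.ind_isIrreducible hN hNM hM)
  quotient_structure := hquot
  dim_one_or_two := hdim
  bijection := (inductionBijective_of_ind_isIrreducible (fun c hc => hNM (hN.mem_of_mem c hc))
    (IrrOver.ind_isIrreducible hN hNM hM)).nonempty

theorem commutator_mem_iff_commute (a b : inertiaGroup χ) :
    ((a * b * a⁻¹ * b⁻¹ : inertiaGroup χ) : G) ∈ K ↔
      Commute (QuotientGroup.mk' K a) (QuotientGroup.mk' K b) := by
  rw [← QuotientGroup.eq_one_iff]
  change QuotientGroup.mk' K ((a : G) * b * (a : G)⁻¹ * (b : G)⁻¹) = 1 ↔ _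
  rw [map_mul, map_mul, map_mul, map_inv, map_inv, mul_inv_eq_one, mul_inv_eq_iff_eq_mul]
  rfl

theorem IsAbelianOver.mul_comm_quotient (hM : IsAbelianOver χ M) (x y : M ⧸ K.comap (inclG M)) :
    x * y = y * x := by
  obtain ⟨a, rfl⟩ := QuotientGroup.mk_surjective x
  obtain ⟨b, rfl⟩ := QuotientGroup.mk_surjective y
  have h := (hM.commutator a a.2 b b.2).1
  have h1 : ((a * b * a⁻¹ * b⁻¹ : M) : M ⧸ K.comap (inclG M)) = 1 :=
    (QuotientGroup.eq_one_iff _).2 h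
  rw [QuotientGroup.mk_mul, QuotientGroup.mk_mul, QuotientGroup.mk_mul, QuotientGroup.mk_inv,
    QuotientGroup.mk_inv, mul_inv_eq_one, mul_inv_eq_iff_eq_mul] at h1
  exact h1

/-- If `M = N ∪ N e` with `e² ∈ K` and `e ∉ N`, then `M / K` is a semidirect product of `N / K` and
a group of order two. -/
theorem IsAbelianOver.exists_isComplement' [N.Normal] (hN : IsAbelianOver χ N)
    {e : inertiaGroup χ} (he : e ∈ M) (heN : e ∉ N) (he2 : ((e * e : inertiaGroup χ) : G) ∈ K)
    (hM : ∀ m ∈ M, m ∈ N ∨ m * e⁻¹ ∈ N) :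
    ∃ B D : Subgroup (M ⧸ K.comap (inclG M)),
      B.Normal ∧ (∀ x ∈ B, ∀ y ∈ B, x * y = y * x) ∧ Nat.card D = 2 ∧ B.IsComplement' D := by
  let q := QuotientGroup.mk' (K.comap (inclG M))
  have hq : Function.Surjective q := QuotientGroup.mk'_surjective _
  have hB : ∀ m : M, q m ∈ (N.subgroupOf M).map q ↔ (m : inertiaGroup χ) ∈ N := by
    refine fun m => ⟨fun ⟨n, hn, h⟩ => ?_, fun h => ⟨m, h, rfl⟩⟩
    have h1 : n⁻¹ * m ∈ K.comap (inclG M) := QuotientGroup.eq.1 h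
    have h2 := N.mul_mem hn (hN.mem_of_mem ((n⁻¹ * m : M) : inertiaGroup χ) h1)
    simpa using h2
  have hsq : q ⟨e, he⟩ ^ 2 = 1 := by
    rw [← map_pow]
    refine (QuotientGroup.eq_one_iff _).2 ?_
    rw [pow_two]
    exact he2
  have hne : q ⟨e, he⟩ ∉ (N.subgroupOf M).map q := fun h => heN ((hB _).1 h)
  refine ⟨(N.subgroupOf M).map q, Subgroup.zpowers (q ⟨e, he⟩),
    Subgroup.Normal.map inferInstance q hq, ?_, ?_, ?_⟩
  · rintro _ ⟨a, ha, rfl⟩ _ ⟨b, hb, rfl⟩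
    have h1 : q (a * b * a⁻¹ * b⁻¹) = 1 :=
      (QuotientGroup.eq_one_iff _).2 (hN.commutator a ha b hb).1
    rw [map_mul, map_mul, map_mul, map_inv, map_inv, mul_inv_eq_one, mul_inv_eq_iff_eq_mul] at h1
    exact h1
  · rw [Nat.card_zpowers]
    exact orderOf_eq_prime hsq fun h => hne (h ▸ Subgroup.one_mem _)
  · refine Subgroup.isComplement'_of_disjoint_and_mul_eq_univ ?_ ?_
    · rw [Subgroup.disjoint_def]
      rintro x hx ⟨k, rfl⟩
      change q ⟨e, he⟩ ^ k ∈ _ at hx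
      change q ⟨e, he⟩ ^ k = 1
      have hsq' : q ⟨e, he⟩ ^ (2 : ℤ) = 1 := by exact_mod_cast hsq
      obtain ⟨j, rfl | rfl⟩ := Int.even_or_odd' k
      · rw [zpow_mul, hsq', one_zpow]
      · rw [zpow_add, zpow_mul, hsq', one_zpow, one_mul, zpow_one] at hx
        exact absurd hx hne
    · refine Set.eq_univ_of_forall fun x => ?_
      obtain ⟨m, rfl⟩ := hq x
      rcases hM m m.2 with h | h
      · exact Set.mem_mul.2 ⟨q m, (hB m).2 h, 1, Subgroup.one_mem _, mul_one _⟩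
      · refine Set.mem_mul.2 ⟨q (m * ⟨e, he⟩⁻¹), (hB _).2 h, q ⟨e, he⟩,
          Subgroup.mem_zpowers _, ?_⟩
        rw [← map_mul, inv_mul_cancel_right]

/-- Existence, uniqueness and the induction bijection for the Clifford subgroup, given an abelian
layer `N` in the inertia group and suitable coset representatives of it. -/
theorem IsTransversalOver.existsUnique_isCliffordSubgroup [Finite G] [N.Normal] {C : Subgroup G}
    (hCχ : C ≤ inertiaGroup χ) (hC : C.subgroupOf (inertiaGroup χ) = N)
    (hN : IsAbelianOver χ N) {E : Set (inertiaGroup χ)} (hE : IsTransversalOver χ N E)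
    (hkey : ∀ e ∈ E, ∀ e' ∈ E, IsTrivialOnCommutators χ N e → IsTrivialOnCommutators χ N e' →
      e' ∉ N → (∃ n ∈ N, ((e * n * e⁻¹ * n⁻¹ : inertiaGroup χ) : G) ∉ K) → e' * e⁻¹ ∈ N) :
    (∃! M : Subgroup (inertiaGroup χ), IsCliffordSubgroup C χ M) ∧
      ∀ (M : Subgroup (inertiaGroup χ)) [M.Normal],
        IsCliffordSubgroup C χ M → InductionBijective χ M := by
  suffices h : ∃ M : Subgroup (inertiaGroup χ), N ≤ M ∧
      (∀ χ₁ : N →* ℂˣ, Extends χ χ₁ → inertiaGroup χ₁ ≤ M) ∧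
      (∃ χ' : M →* ℂˣ, Extends χ χ') ∧
      ((∀ x y : M ⧸ K.comap (inclG M), x * y = y * x) ∨
      ∃ B D : Subgroup (M ⧸ K.comap (inclG M)),
        B.Normal ∧ (∀ x ∈ B, ∀ y ∈ B, x * y = y * x) ∧ Nat.card D = 2 ∧ B.IsComplement' D) ∧
      (∀ ρ : IrrOver χ (inclG M),
        Module.finrank ℂ ρ.rep = 1 ∨ Module.finrank ℂ ρ.rep = 2) by
    obtain ⟨M, hNM, hM, ⟨χ', hχ'⟩, hquot, hdim⟩ := h
    have := hE.normal hNM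
    refine ⟨⟨M, isCliffordSubgroup_of_inertiaGroup_le hCχ hC hN hNM hM ⟨χ', hχ'⟩ hquot hdim,
      fun M' hM' => hM'.eq hC hM hχ'⟩, fun M' _ hM' => ?_⟩
    obtain rfl := hM'.eq hC hM hχ'
    exact inductionBijective_of_ind_isIrreducible (fun c hc => hNM (hN.mem_of_mem c hc))
      hM'.ind_irreducible
  -- The dichotomy: either every stabilizer commutes with N modulo K, or some representative e in a
  -- stabilizer does not, and then `hkey` leaves only the cosets N and N e.
  by_cases h : ∀ χ₁ : N →* ℂˣ, Extends χ χ₁ → ∀ g ∈ inertiaGroup χ₁, ∀ n ∈ N,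
      ((g * n * g⁻¹ * n⁻¹ : inertiaGroup χ) : G) ∈ K
  · obtain ⟨χ₁, hext⟩ := hN.exists_extends
    have hab := hE.isAbelianOver_inertiaGroup hN hext (h χ₁ hext)
    -- An element stabilizing χ₂ changes n by a commutator in K on which χ₂, hence χ, hence χ₁, is
    -- trivial. So all stabilizers are equal.
    refine ⟨inertiaGroup χ₁, le_inertiaGroup χ₁, fun χ₂ hext₂ g hg n => ?_,
      hE.exists_extends_inertiaGroup hN hext, Or.inl hab.mul_comm_quotient,
      fun ρ => Or.inl (ρ.finrank_eq_one hab)⟩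
    have hk := h χ₂ hext₂ g hg n n.2
    have h1 : MulAut.conjNormal g n = (⟨_, hN.mem_of_mem _ hk⟩ : N) * n :=
      Subtype.ext (inv_mul_cancel_right _ _).symm
    have h2 : χ₁ ⟨_, hN.mem_of_mem _ hk⟩ = 1 := (hext _ hk).trans
      ((hext₂ ⟨_, hN.mem_of_mem _ hk⟩ hk).symm.trans (Extends.apply_commutator hg n.2 _))
    rw [h1, map_mul, h2, one_mul]
  · push Not at h
    obtain ⟨χ₁, hext, g, hg, n, hn, hk⟩ := h
    obtain ⟨n₀, hn₀, e, he, rfl⟩ := hE.exists_mul g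
    have hmem : ∀ {θ : N →* ℂˣ} {a b}, a ∈ N → a * b ∈ inertiaGroup θ → b ∈ inertiaGroup θ :=
      fun {θ a b} ha hab => by
        simpa using Subgroup.mul_mem _ (Subgroup.inv_mem _ (le_inertiaGroup θ ha)) hab
    have he1 : e ∈ inertiaGroup χ₁ := hmem hn₀ hg
    have hek : ((e * n * e⁻¹ * n⁻¹ : inertiaGroup χ) : G) ∉ K := by
      refine fun h1 => hk ?_
      have h2 := (hN.commutator n₀ hn₀ n hn).1
      rw [commutator_mem_iff_commute] at h1 h2 ⊢
      rw [Subgroup.coe_mul, map_mul]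
      exact h2.mul_left h1
    have heN : e ∉ N := fun h1 => hek (hN.commutator e h1 n hn).1
    have hcov : ∀ θ : N →* ℂˣ, Extends χ θ → ∀ m ∈ inertiaGroup θ, m ∈ N ∨ m * e⁻¹ ∈ N := by
      intro θ hθ m hm
      obtain ⟨n', hn', e', he', rfl⟩ := hE.exists_mul m
      by_cases h1 : e' ∈ N
      · exact Or.inl (N.mul_mem hn' h1)
      · refine Or.inr ?_
        rw [mul_assoc]
        exact N.mul_mem hn' (hkey e he e' he' (hext.isTrivialOnCommutators hN he1)
          (hθ.isTrivialOnCommutators hN (hmem hn' hm)) h1 ⟨n, hn, hek⟩)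
    refine ⟨inertiaGroup χ₁, le_inertiaGroup χ₁, fun χ₂ hext₂ m hm => ?_,
      hE.exists_extends_inertiaGroup hN hext, Or.inr (hN.exists_isComplement'
        he1 heN (hE.sq_mem e he) (hcov χ₁ hext)),
      IrrOver.finrank_eq_one_or_two hN (le_inertiaGroup χ₁) he1 (hcov χ₁ hext)⟩
    rcases hcov χ₂ hext₂ m hm with h1 | h1
    · exact le_inertiaGroup χ₁ h1
    · simpa using Subgroup.mul_mem _ (le_inertiaGroup χ₁ h1) he1

end CliffordTheory

/-! ### The norm-one condition on the entry x of a unipotent representative. -/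

section Arithmetic

variable {R R' : Type*} [CommRing R] [CommRing R'] {φ : R →+* R'} {ψ : AddChar R ℂˣ}

/-- The properties of the projection `𝔬_{2ℓ} → 𝔬_ℓ` and of a primitive additive character of
`𝔬_{2ℓ}` on which the analysis of the extensions of `ψ_{[A]}` rests. -/
structure IsPrimitiveOver (φ : R →+* R') (ψ : AddChar R ℂˣ) : Prop where
  mul_eq_zero : ∀ {a b}, φ a = 0 → φ b = 0 → a * b = 0
  eq_zero : ∀ {y}, (∀ u, φ u = 0 → ψ (y * u) = 1) → φ y = 0
  exists_ne_one : ∀ {a b}, φ a ≠ 0 → φ b ≠ 0 →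
    ∃ s, (∀ r, IsUnit (1 + s * r)) ∧ φ (s * a) = 0 ∧ φ (s * b) = 0 ∧ ψ (s * a * b) ≠ 1

/-- The condition on `x` for `ψ_{[A]}` to be trivial on the commutators in `K^ℓ` of the unipotent
element with entry `x` and the elements of the stabilizer of `ψ_A`. -/
def IsTrivialOnNormOne (φ : R →+* R') (ψ : AddChar R ℂˣ) (t d x : R) : Prop :=
  ∀ p q, IsUnit p → φ (p ^ 2 + t * p * q + d * q ^ 2) = 1 → φ (x * q) = 0 →
    ψ (x * (1 - (p ^ 2 + t * p * q + d * q ^ 2)) - x ^ 2 * p * q) = 1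

namespace IsTrivialOnNormOne

variable {t d x y p q : R}

/-- The condition evaluated on the norm one elements obtained by scaling `p + q A - 1`. -/
theorem apply_eq_one (hx : IsTrivialOnNormOne φ ψ t d x)
    (hpq : φ (p ^ 2 + t * p * q + d * q ^ 2) = 1) {s : R} (hs : ∀ r, IsUnit (1 + s * r))
    (hsT : φ (s * (2 * p + t * q - 2)) = 0) (hsq : φ (s * q * x) = 0) :
    ψ (-(s * x * (1 - s) * (2 * p + t * q - 2)
      + s ^ 2 * x * (p ^ 2 + t * p * q + d * q ^ 2 - 1))
      - s * x ^ 2 * (1 + s * (p - 1)) * q) = 1 := by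
  -- These are the coordinates of 1 + s(p + qA − 1). With ν the norm of p + qA and T = 2p + tq − 2,
  -- its norm is 1 + s(1 − s)T + s²(ν − 1).
  have h1 := hx (1 + s * (p - 1)) (s * q) (hs _) ?_ ?_
  · convert h1 using 2
    ring
  · have h2 : (1 + s * (p - 1)) ^ 2 + t * (1 + s * (p - 1)) * (s * q) + d * (s * q) ^ 2 =
      1 + s * (2 * p + t * q - 2) * (1 - s) + s ^ 2 * (p ^ 2 + t * p * q + d * q ^ 2 - 1) := by
      ring
    rw [h2, map_add, map_add, map_mul, map_mul φ (s ^ 2), hsT, map_sub φ _ 1, hpq]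
    simp
  · rw [← hsq]
    congr 1
    ring

/-- Write τ for the element 2(p − 1) + q(t + x). If τ were nonzero modulo the kernel, s could be
chosen to kill sx and sτ there while ψ(sxτ) ≠ 1. For this s the scaled condition collapses to
ψ(−sxτ) = 1. -/
theorem trace_eq_zero (h : IsPrimitiveOver φ ψ) (hx : IsTrivialOnNormOne φ ψ t d x)
    (hx0 : φ x ≠ 0) (hpq : φ (p ^ 2 + t * p * q + d * q ^ 2) = 1) :
    φ (2 * (p - 1) + q * (t + x)) = 0 := by
  by_contra hτ
  obtain ⟨s, hs, hsx, hsτ, hne⟩ := h.exists_ne_one hx0 hτ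
  have hν : φ (p ^ 2 + t * p * q + d * q ^ 2 - 1) = 0 := by rw [map_sub, hpq, map_one, sub_self]
  have hsT : φ (s * (2 * p + t * q - 2)) = 0 := by
    have : s * (2 * p + t * q - 2) = s * (2 * (p - 1) + q * (t + x)) - q * (s * x) := by ring
    rw [this, map_sub, map_mul φ q, hsτ, hsx, mul_zero, sub_zero]
  have hsq : φ (s * q * x) = 0 := by
    rw [mul_right_comm, map_mul, hsx, zero_mul]
  have h1 := apply_eq_one hx hpq hs hsT hsq
  refine hne ?_
  rw [← inv_inj, ← AddChar.map_neg_eq_inv, inv_one, ← h1]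
  congr 1
  linear_combination (-1 : R) * h.mul_eq_zero hsx hsT + s * h.mul_eq_zero hsx hν
    + (p - 1) * q * h.mul_eq_zero hsx hsx

/-- The trace relations for x and y give q(x − y) ≡ 0, and 2y ≡ 0 turns this into q(x + y) ≡ 0, so
the quadratic terms of the two conditions cancel. What remains pairs x − y with T = 2p + tq − 2,
which is nonzero modulo the kernel because qx is. -/
theorem sub_eq_zero (h : IsPrimitiveOver φ ψ) (hx : IsTrivialOnNormOne φ ψ t d x)
    (hy : IsTrivialOnNormOne φ ψ t d y) (hx0 : φ x ≠ 0) (hy0 : φ y ≠ 0) (hy2 : φ (2 * y) = 0)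
    (hpq : φ (p ^ 2 + t * p * q + d * q ^ 2) = 1) (hqx : φ (q * x) ≠ 0) : φ (x - y) = 0 := by
  have hTx := trace_eq_zero h hx hx0 hpq
  have hTy := trace_eq_zero h hy hy0 hpq
  have hν : φ (p ^ 2 + t * p * q + d * q ^ 2 - 1) = 0 := by rw [map_sub, hpq, map_one, sub_self]
  have hqz : φ (q * (x - y)) = 0 := by
    have : q * (x - y) = (2 * (p - 1) + q * (t + x)) - (2 * (p - 1) + q * (t + y)) := by ring
    rw [this, map_sub, hTx, hTy, sub_zero]
  have hqs : φ (q * (x + y)) = 0 := by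
    have : q * (x + y) = q * (x - y) + q * (2 * y) := by ring
    rw [this, map_add, hqz, map_mul, hy2, mul_zero, add_zero]
  have hT0 : φ (2 * p + t * q - 2) ≠ 0 := by
    intro h0
    refine hqx ?_
    have : q * x = (2 * (p - 1) + q * (t + x)) - (2 * p + t * q - 2) := by ring
    rw [this, map_sub, hTx, h0, sub_zero]
  by_contra hz
  obtain ⟨s, hs, hsz, hsT, hne⟩ := h.exists_ne_one hz hT0
  have hsx : φ (s * q * x) = 0 := by
    have : s * q * x = s * (2 * (p - 1) + q * (t + x)) - s * (2 * p + t * q - 2) := by ring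
    rw [this, map_sub, map_mul, hTx, hsT, mul_zero, sub_zero]
  have hsy : φ (s * q * y) = 0 := by
    have : s * q * y = s * q * x - s * (q * (x - y)) := by ring
    rw [this, map_sub, map_mul φ s (q * (x - y)), hqz, hsx, mul_zero, sub_zero]
  have h1 := apply_eq_one hx hpq hs hsT hsx
  have h2 := apply_eq_one hy hpq hs hsT hsy
  refine hne ?_
  rw [← div_self' (1 : ℂˣ)]
  nth_rw 1 [← h2]
  rw [← h1, ← AddChar.map_sub_eq_div]
  congr 1
  linear_combination h.mul_eq_zero hsz hsT - s * h.mul_eq_zero hsz hν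
    - (1 + s * (p - 1)) * h.mul_eq_zero hsz hqs

end IsTrivialOnNormOne

/-- Every element outside the kernel of `𝔬_{2ℓ} → 𝔬_ℓ` is a unit times a power of the
uniformizer with exponent less than `ℓ`. -/
theorem exists_eq_mul_pow {𝒪 : Type*} [CommRing 𝒪] [IsDomain 𝒪] [IsDiscreteValuationRing 𝒪]
    {ℓ : ℕ} {ϖ : 𝒪} (hϖ : Irreducible ϖ) {a : TruncRing 𝒪 (2 * ℓ)} (ha : truncMap 𝒪 ℓ a ≠ 0) :
    ∃ (i : ℕ) (u : (TruncRing 𝒪 (2 * ℓ))ˣ), i < ℓ ∧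
      a = u * (Ideal.Quotient.mk _ ϖ : TruncRing 𝒪 (2 * ℓ)) ^ i := by
  obtain ⟨a, rfl⟩ := Ideal.Quotient.mk_surjective a
  have ha0 : a ≠ 0 := by
    rintro rfl
    simp at ha
  obtain ⟨i, u, rfl⟩ := IsDiscreteValuationRing.eq_unit_mul_pow_irreducible ha0 hϖ
  refine ⟨i, u.map (Ideal.Quotient.mk _).toMonoidHom, ?_, by simp⟩
  by_contra! hi
  refine ha ?_
  rw [Ideal.Quotient.factor_mk, Ideal.Quotient.eq_zero_iff_mem]
  exact Ideal.mul_mem_left _ _ (Ideal.pow_le_pow_right hi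
    (Ideal.pow_mem_pow ((mem_maximalIdeal _).2 hϖ.not_isUnit) i))

theorem truncMap_pow_eq_zero {𝒪 : Type*} [CommRing 𝒪] [IsLocalRing 𝒪] {ℓ : ℕ} {ϖ : 𝒪}
    (hϖ : Irreducible ϖ) {i : ℕ} (hi : ℓ ≤ i) :
    truncMap 𝒪 ℓ ((Ideal.Quotient.mk _ ϖ) ^ i) = 0 := by
  rw [← map_pow, Ideal.Quotient.factor_mk, Ideal.Quotient.eq_zero_iff_mem]
  exact Ideal.pow_le_pow_right hi (Ideal.pow_mem_pow ((mem_maximalIdeal _).2 hϖ.not_isUnit) i)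

theorem isPrimitiveOver_truncMap {𝒪 : Type*} [CommRing 𝒪] [IsDomain 𝒪]
    [IsDiscreteValuationRing 𝒪] {ℓ : ℕ} {ϖ : 𝒪} (hϖ : Irreducible ϖ)
    (ψ : AddChar (TruncRing 𝒪 (2 * ℓ)) ℂˣ)
    (hψ : ψ (Ideal.Quotient.mk _ (ϖ ^ (2 * ℓ - 1))) ≠ 1) :
    IsPrimitiveOver (truncMap 𝒪 ℓ) ψ where
  mul_eq_zero := mul_eq_zero_of_truncMap
  eq_zero := by
    intro y hy
    by_contra h
    obtain ⟨i, u, hi, rfl⟩ := exists_eq_mul_pow hϖ h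
    refine hψ ?_
    have h1 := hy (((u⁻¹ : (TruncRing 𝒪 (2 * ℓ))ˣ) : TruncRing 𝒪 (2 * ℓ)) *
      (Ideal.Quotient.mk _ ϖ) ^ (2 * ℓ - 1 - i)) (by
      rw [map_mul, truncMap_pow_eq_zero hϖ (by omega), mul_zero])
    rw [← h1, map_pow, mul_mul_mul_comm, Units.mul_inv, one_mul, ← pow_add]
    congr 2
    omega
  exists_ne_one := by
    intro a b ha hb
    obtain ⟨i, u, hi, rfl⟩ := exists_eq_mul_pow hϖ ha
    obtain ⟨j, v, hj, rfl⟩ := exists_eq_mul_pow hϖ hb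
    set w : TruncRing 𝒪 (2 * ℓ) := Ideal.Quotient.mk _ ϖ with hw
    -- The exponent makes s·a·b equal to ϖ^(2ℓ−1), where ψ is nontrivial. Since i, j < ℓ, it is at
    -- least one, so s is nilpotent, and sa, sb have valuation at least ℓ.
    refine ⟨↑(u * v)⁻¹ * w ^ (2 * ℓ - 1 - i - j), fun r => ?_, ?_, ?_, ?_⟩
    · refine IsNilpotent.isUnit_one_add ⟨2 * ℓ, ?_⟩
      have h0 : w ^ (2 * ℓ) = 0 := by
        rw [hw, ← map_pow, Ideal.Quotient.eq_zero_iff_mem]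
        exact Ideal.pow_mem_pow ((mem_maximalIdeal _).2 hϖ.not_isUnit) _
      rw [mul_pow, mul_pow, ← pow_mul, mul_comm (2 * ℓ - 1 - i - j), pow_mul w, h0,
        zero_pow (by omega), mul_zero, zero_mul]
    · rw [mul_mul_mul_comm, ← pow_add, map_mul, truncMap_pow_eq_zero hϖ (by omega), mul_zero]
    · rw [mul_mul_mul_comm, ← pow_add, map_mul, truncMap_pow_eq_zero hϖ (by omega), mul_zero]
    · have h1 : ↑(u * v)⁻¹ * w ^ (2 * ℓ - 1 - i - j) * (u * w ^ i) * (v * w ^ j) =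
          (↑(u * v)⁻¹ * ↑(u * v)) * (w ^ (2 * ℓ - 1 - i - j) * w ^ i * w ^ j) := by
        rw [Units.val_mul]
        ring
      rw [h1, Units.inv_mul, one_mul, ← pow_add, ← pow_add, hw, ← map_pow]
      convert hψ using 6
      omega

end Arithmetic

/-! ### Two-by-two matrices and the centralizer of a companion matrix. -/

section SpecialLinear

open Matrix

variable {R R' : Type*} [CommRing R] [CommRing R'] {φ : R →+* R'} {ψ : AddChar R ℂˣ} {t d : R}

/-- The matrix underlying an element of the special linear group. -/
def toMat (M : SpecialLinearGroup (Fin 2) R) : Matrix (Fin 2) (Fin 2) R := M.1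

theorem toMat_injective : Function.Injective (toMat (R := R)) := Subtype.val_injective

theorem toMat_mul (M N : SpecialLinearGroup (Fin 2) R) : toMat (M * N) = toMat M * toMat N := rfl

theorem toMat_one : toMat (1 : SpecialLinearGroup (Fin 2) R) = 1 := rfl

theorem toMat_map (M : SpecialLinearGroup (Fin 2) R) :
    toMat (SpecialLinearGroup.map φ M) = (toMat M).map φ := rfl

theorem toMat_inv {M : SpecialLinearGroup (Fin 2) R} {p q r s : R} (hM : toMat M = !![p, r; q, s]) :
    toMat M⁻¹ = !![s, -r; -q, p] := by
  change adjugate (toMat M) = _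
  rw [hM, adjugate_fin_two_of]

theorem exists_toMat_eq (M : SpecialLinearGroup (Fin 2) R) :
    ∃ p r q s, toMat M = !![p, r; q, s] ∧ p * s - r * q = 1 := by
  refine ⟨_, _, _, _, eta_fin_two _, ?_⟩
  rw [← det_fin_two]
  exact M.2

/-- The unipotent upper triangular matrix with entry `x`. -/
def upperSL (x : R) : SpecialLinearGroup (Fin 2) R := ⟨!![1, x; 0, 1], by simp [det_fin_two]⟩

theorem toMat_upperSL (x : R) : toMat (upperSL x) = !![1, x; 0, 1] := rfl

theorem upperSL_add (x y : R) : upperSL (x + y) = upperSL x * upperSL y := by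
  refine toMat_injective ?_
  simp [toMat_mul, toMat_upperSL, add_comm]

theorem upperSL_zero : upperSL (0 : R) = 1 := by
  refine toMat_injective ?_
  rw [toMat_upperSL, toMat_one, one_fin_two]

theorem upperSL_neg (x : R) : upperSL (-x) = (upperSL x)⁻¹ := by
  rw [eq_inv_iff_mul_eq_one, ← upperSL_add, neg_add_cancel, upperSL_zero]

theorem map_upperSL_eq_one {x : R} (hx : φ x = 0) :
    SpecialLinearGroup.map φ (upperSL x) = 1 := by
  refine toMat_injective ?_
  rw [toMat_map, toMat_upperSL, toMat_one, one_fin_two]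
  ext i j
  fin_cases i <;> fin_cases j <;> simp [hx]

/-- The companion matrix of `X² - t X + d`. -/
def companionTwo (t d : R) : Matrix (Fin 2) (Fin 2) R := !![0, -d; 1, t]

/-- The image of `M` modulo the kernel of `φ` commutes with the companion matrix. -/
def CentralizesCompanion (φ : R →+* R') (t d : R) (M : SpecialLinearGroup (Fin 2) R) : Prop :=
  φ (toMat M 0 1) = -(φ d * φ (toMat M 1 0)) ∧
    φ (toMat M 1 1) = φ (toMat M 0 0) + φ t * φ (toMat M 1 0)

/-- The coefficients of a, b, c, e are the entries of M⁻¹AM − A at (1,1), (2,1), (1,2), (2,2), where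
A is the companion matrix. -/
theorem trace_companionTwo_conj {M : SpecialLinearGroup (Fin 2) R} {p q r s : R}
    (hM : toMat M = !![p, r; q, s]) (a b c e : R) :
    trace (companionTwo t d * (toMat M * !![a, b; c, e] * toMat M⁻¹)) =
      trace (companionTwo t d * !![a, b; c, e])
      + (-(d * q * s) - r * p - t * r * q) * a + (d - (d * s ^ 2 + t * r * s + r ^ 2)) * c
      + (p ^ 2 + t * p * q + d * q ^ 2 - 1) * b + (d * q * s + p * r + t * p * s - t) * e := by
  rw [toMat_inv hM, hM, companionTwo]
  simp only [mul_fin_two, trace_fin_two_of]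
  ring

/-- The hypotheses say that M⁻¹AM has first column (x, 1). So the second column of M is (A − x)
applied to its first. -/
theorem companion_identities {p q r s t d x : R'} (h : p * s - r * q = 1)
    (h₂₁ : p ^ 2 + t * p * q + d * q ^ 2 = 1)
    (hx : x = -(d * q * s) - r * p - t * r * q) :
    r = -(d * q) - x * p ∧ s = p + t * q - x * q := by
  subst hx
  constructor
  · linear_combination (-r) * h₂₁ - d * q * h
  · linear_combination (-s) * h₂₁ + (p + t * q) * h

/-- Conjugation preserves the determinant, and det(A + x) = d + tx + x². -/
theorem companion_quadratic {p q r s t d x : R'} (h : p * s - r * q = 1)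
    (h₂₁ : p ^ 2 + t * p * q + d * q ^ 2 = 1) (h₁₂ : d * s ^ 2 + t * r * s + r ^ 2 = d)
    (hx : x = -(d * q * s) - r * p - t * r * q) (h2 : 2 * x = 0) : x ^ 2 + t * x = 0 := by
  have h1 : x ^ 2 + t * x - t * (2 * x) + x * t * (1 - (p * s - r * q)) -
      ((d * s ^ 2 + t * r * s + r ^ 2) * (p ^ 2 + t * p * q + d * q ^ 2)
        - d * (p * s - r * q) ^ 2) = 0 := by
    rw [hx]
    ring
  rw [h, h2, h₂₁, h₁₂] at h1
  linear_combination h1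

/-- By primitivity, ψ detects the entries of M⁻¹AM − A modulo the kernel. For the converse the first
column suffices, since det M = 1 then determines the second column of M. -/
theorem centralizesCompanion_iff (hφ : IsPrimitiveOver φ ψ) (M : SpecialLinearGroup (Fin 2) R) :
    CentralizesCompanion φ t d M ↔ ∀ X : Matrix (Fin 2) (Fin 2) R, X.map φ = 0 →
      ψ (trace (companionTwo t d * (toMat M * X * toMat M⁻¹))) =
        ψ (trace (companionTwo t d * X)) := by
  obtain ⟨p, r, q, s, hM, hdet⟩ := exists_toMat_eq M
  replace hdet := congrArg φ hdet
  simp only [map_sub, map_mul, map_one] at hdet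
  constructor
  · rintro ⟨h1, h2⟩ X hX
    simp only [hM, of_apply, cons_val', cons_val_zero, cons_val_one, cons_val_fin_one] at h1 h2
    rw [h1, h2] at hdet
    have hX' : ∀ i j, φ (X i j) = 0 := fun i j => congrFun (congrFun hX i) j
    rw [eta_fin_two X, trace_companionTwo_conj hM]
    congr 1
    have e1 : φ (-(d * q * s) - r * p - t * r * q) = 0 := by
      simp only [map_sub, map_neg, map_mul, h1, h2]
      ring
    have e2 : φ (d - (d * s ^ 2 + t * r * s + r ^ 2)) = 0 := by
      simp only [map_sub, map_add, map_mul, map_pow, h1, h2]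
      linear_combination (-φ d) * hdet
    have e3 : φ (p ^ 2 + t * p * q + d * q ^ 2 - 1) = 0 := by
      simp only [map_sub, map_add, map_mul, map_pow, map_one]
      linear_combination hdet
    have e4 : φ (d * q * s + p * r + t * p * s - t) = 0 := by
      simp only [map_sub, map_add, map_mul, h1, h2]
      linear_combination (φ t) * hdet
    rw [hφ.mul_eq_zero e1 (hX' 0 0), hφ.mul_eq_zero e2 (hX' 1 0), hφ.mul_eq_zero e3 (hX' 0 1),
      hφ.mul_eq_zero e4 (hX' 1 1)]
    simp only [add_zero]
  · intro h
    have h11 : φ (-(d * q * s) - r * p - t * r * q) = 0 := by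
      refine hφ.eq_zero fun u hu => ?_
      have := h !![u, 0; 0, 0] (by ext i j; fin_cases i <;> fin_cases j <;> simp [hu])
      rw [trace_companionTwo_conj hM] at this
      simpa [AddChar.map_add_eq_mul] using this
    have h21 : φ (p ^ 2 + t * p * q + d * q ^ 2 - 1) = 0 := by
      refine hφ.eq_zero fun u hu => ?_
      have := h !![0, u; 0, 0] (by ext i j; fin_cases i <;> fin_cases j <;> simp [hu])
      rw [trace_companionTwo_conj hM] at this
      simpa [AddChar.map_add_eq_mul] using this
    simp only [map_sub, map_neg, map_add, map_mul, map_pow, map_one] at h11 h21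
    obtain ⟨h1, h2⟩ := companion_identities hdet (sub_eq_zero.1 h21) h11.symm
    exact ⟨by simpa [hM] using h1, by simpa [hM] using h2⟩

/-- If conjugation by `M` preserves the character `X ↦ ψ(tr(A X))` on traceless matrices, then
`M` is the product of a matrix centralizing `A` and a unipotent matrix. -/
theorem exists_centralizesCompanion_mul (hφ : IsPrimitiveOver φ ψ)
    {M : SpecialLinearGroup (Fin 2) R}
    (h : ∀ X : Matrix (Fin 2) (Fin 2) R, X.map φ = 0 → trace X = 0 →
      ψ (trace (companionTwo t d * (toMat M * X * toMat M⁻¹))) =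
        ψ (trace (companionTwo t d * X))) :
    ∃ x, φ (2 * x) = 0 ∧ φ (x ^ 2 + t * x) = 0 ∧
      CentralizesCompanion φ t d (M * (upperSL x)⁻¹) := by
  obtain ⟨p, r, q, s, hM, hdet⟩ := exists_toMat_eq M
  replace hdet := congrArg φ hdet
  have h21 : φ (p ^ 2 + t * p * q + d * q ^ 2 - 1) = 0 := by
    refine hφ.eq_zero fun u hu => ?_
    have := h !![0, u; 0, 0] (by ext i j; fin_cases i <;> fin_cases j <;> simp [hu])
      (by simp [trace_fin_two])
    rw [trace_companionTwo_conj hM] at this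
    simpa [AddChar.map_add_eq_mul] using this
  have h12 : φ (d - (d * s ^ 2 + t * r * s + r ^ 2)) = 0 := by
    refine hφ.eq_zero fun u hu => ?_
    have := h !![0, 0; u, 0] (by ext i j; fin_cases i <;> fin_cases j <;> simp [hu])
      (by simp [trace_fin_two])
    rw [trace_companionTwo_conj hM] at this
    simpa [AddChar.map_add_eq_mul] using this
  have h11 : φ ((-(d * q * s) - r * p - t * r * q) - (d * q * s + p * r + t * p * s - t)) = 0 := by
    refine hφ.eq_zero fun u hu => ?_
    have := h !![u, 0; 0, -u] (by ext i j; fin_cases i <;> fin_cases j <;> simp [hu])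
      (by simp [trace_fin_two])
    rw [trace_companionTwo_conj hM, add_assoc, add_assoc, add_assoc, AddChar.map_add_eq_mul,
      mul_eq_left] at this
    rw [← this]
    congr 1
    ring
  simp only [map_sub, map_neg, map_add, map_mul, map_pow, map_one] at hdet h11 h12 h21
  have hx : φ (-(d * q * s) - r * p - t * r * q) =
      -(φ d * φ q * φ s) - φ r * φ p - φ t * φ r * φ q := by
    simp only [map_sub, map_neg, map_mul]
  obtain ⟨h1, h2⟩ := companion_identities hdet (sub_eq_zero.1 h21) hx
  have h2x : 2 * φ (-(d * q * s) - r * p - t * r * q) = 0 := by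
    rw [hx]
    linear_combination h11 + φ t * hdet
  have hxx := companion_quadratic hdet (sub_eq_zero.1 h21) (sub_eq_zero.1 h12).symm hx h2x
  -- The (1,1) entry of M⁻¹AM. Traceless tests determine M⁻¹AM − A up to a scalar, which is this x;
  -- equality of traces gives 2x ≡ 0.
  refine ⟨-(d * q * s) - r * p - t * r * q, by rw [map_mul, map_ofNat, h2x],
    by rw [map_add, map_pow, map_mul, hxx], ?_⟩
  generalize -(d * q * s) - r * p - t * r * q = x at *
  rw [CentralizesCompanion, ← upperSL_neg, toMat_mul, toMat_upperSL, hM]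
  simp only [mul_fin_two, of_apply, cons_val', cons_val_zero, cons_val_one, cons_val_fin_one,
    map_add, map_mul, map_neg, map_one, map_zero]
  constructor
  · linear_combination h1 - φ p * h2x
  · linear_combination h2 - φ q * h2x

/-- For r = −dq and s = p + tq + δ the value is xpδ − x²pq, the source of `IsTrivialOnNormOne`. -/
theorem trace_commutator_upperSL {M : SpecialLinearGroup (Fin 2) R} {p q r s : R}
    (hM : toMat M = !![p, r; q, s]) (hdet : p * s - r * q = 1) (x : R) :
    trace (companionTwo t d * (toMat (upperSL x * M * (upperSL x)⁻¹ * M⁻¹) - 1)) =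
      x * p * (s - p - t * q - x * q) - x * q * (r + d * q) := by
  rw [← upperSL_neg, toMat_mul, toMat_mul, toMat_mul, toMat_inv hM, hM, toMat_upperSL,
    toMat_upperSL, companionTwo, mul_sub, mul_one, trace_sub]
  simp only [mul_fin_two, trace_fin_two_of]
  linear_combination t * hdet

theorem map_commutator_upperSL {M : SpecialLinearGroup (Fin 2) R}
    (h : CentralizesCompanion φ t d M) {x : R} (hx : φ (x * toMat M 1 0) = 0) :
    SpecialLinearGroup.map φ (upperSL x * M * (upperSL x)⁻¹ * M⁻¹) = 1 := by
  obtain ⟨p, r, q, s, hM, hdet⟩ := exists_toMat_eq M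
  replace hdet := congrArg φ hdet
  obtain ⟨h1, h2⟩ := h
  simp only [hM, of_apply, cons_val', cons_val_zero, cons_val_one, cons_val_fin_one,
    map_sub, map_mul, map_one] at h1 h2 hdet hx
  have h3 : φ x * (φ s - φ p) = 0 := by
    rw [h2]
    linear_combination φ t * hx
  refine toMat_injective ?_
  rw [toMat_map, ← upperSL_neg, toMat_mul, toMat_mul, toMat_mul, toMat_inv hM, hM, toMat_upperSL,
    toMat_upperSL, toMat_one, one_fin_two]
  ext i j
  fin_cases i <;> fin_cases j <;> simp
  · linear_combination hdet + (φ s + φ x * φ q) * hx - φ q * h3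
  · linear_combination (-(φ r + φ x * φ p)) * hx + φ p * h3
  · linear_combination φ q * hx
  · linear_combination hdet - φ p * hx

/-- The two congruences on x say that u_x moves A to A + x modulo the kernel, and A + x has the same
centralizer as A. -/
theorem CentralizesCompanion.conj_upperSL {M : SpecialLinearGroup (Fin 2) R}
    (h : CentralizesCompanion φ t d M) {x : R} (hx : φ (2 * x) = 0) (hx' : φ (x ^ 2 + t * x) = 0) :
    CentralizesCompanion φ t d (upperSL x * M * (upperSL x)⁻¹) := by
  obtain ⟨p, r, q, s, hM, -⟩ := exists_toMat_eq M
  obtain ⟨h1, h2⟩ := h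
  rw [← upperSL_neg]
  rw [CentralizesCompanion, toMat_mul, toMat_mul, toMat_upperSL, toMat_upperSL, hM]
  simp only [hM, mul_fin_two, of_apply, cons_val', cons_val_zero, cons_val_one, cons_val_fin_one,
    map_add, map_mul, map_neg, map_one, map_zero, map_pow, map_ofNat] at h1 h2 hx hx' ⊢
  rw [h1, h2]
  constructor
  · linear_combination φ t * φ q * hx - φ q * hx'
  · linear_combination (-φ q) * hx

theorem CentralizesCompanion.commute {M M' : SpecialLinearGroup (Fin 2) R}
    (h : CentralizesCompanion φ t d M) (h' : CentralizesCompanion φ t d M') :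
    Commute (SpecialLinearGroup.map φ M) (SpecialLinearGroup.map φ M') := by
  obtain ⟨p, r, q, s, hM, -⟩ := exists_toMat_eq M
  obtain ⟨p', r', q', s', hM', -⟩ := exists_toMat_eq M'
  obtain ⟨h1, h2⟩ := h
  obtain ⟨h1', h2'⟩ := h'
  simp only [hM, hM', of_apply, cons_val', cons_val_zero, cons_val_one, cons_val_fin_one]
    at h1 h2 h1' h2'
  refine toMat_injective ?_
  rw [toMat_mul, toMat_mul, toMat_map, toMat_map, hM, hM']
  ext i j
  fin_cases i <;> fin_cases j <;>
    simp [mul_apply, Fin.sum_univ_two, h1, h2, h1', h2'] <;> ring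

theorem mul_eq_mul_of_map_eq (hφ : IsPrimitiveOver φ ψ) {A B C : Matrix (Fin 2) (Fin 2) R}
    (hA : A.map φ = 0) (hBC : B.map φ = C.map φ) : A * B = A * C := by
  rw [← sub_eq_zero, ← mul_sub]
  ext i j
  rw [mul_apply]
  refine Finset.sum_eq_zero fun k _ => hφ.mul_eq_zero (congrFun (congrFun hA i) k) ?_
  rw [Matrix.sub_apply, map_sub, sub_eq_zero]
  exact congrFun (congrFun hBC k) j

/-- Both matrices are polynomials in A plus errors in the kernel of φ. To first order the trace is
that of a commutator with a polynomial in A, multiplied by polynomials in A, so it vanishes;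
products of two errors are zero. -/
theorem CentralizesCompanion.trace_commutator (hφ : IsPrimitiveOver φ ψ)
    {M M' : SpecialLinearGroup (Fin 2) R}
    (h : CentralizesCompanion φ t d M) (h' : CentralizesCompanion φ t d M') :
    trace (companionTwo t d * (toMat (M * M' * M⁻¹ * M'⁻¹) - 1)) = 0 := by
  have e1 : toMat (M * M' * M⁻¹ * M'⁻¹) - 1 =
      (toMat M * toMat M' - toMat M' * toMat M) * (toMat M⁻¹ * toMat M'⁻¹) := by
    have : toMat M' * toMat M * (toMat M⁻¹ * toMat M'⁻¹) = 1 := by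
      rw [← toMat_mul, ← toMat_mul, ← toMat_mul, ← toMat_one]
      congr 1
      group
    rw [sub_mul, this, toMat_mul, toMat_mul, toMat_mul, mul_assoc (toMat M * toMat M')]
  have e0 : (toMat M * toMat M' - toMat M' * toMat M).map φ = 0 := by
    have := congrArg toMat (h.commute h').eq
    rw [toMat_mul, toMat_mul, toMat_map, toMat_map, ← Matrix.map_mul, ← Matrix.map_mul,
      ← sub_eq_zero, ← Matrix.map_sub] at this
    · exact this
    · exact map_sub φ
  obtain ⟨p, r, q, s, hM, -⟩ := exists_toMat_eq M
  obtain ⟨p', r', q', s', hM', -⟩ := exists_toMat_eq M'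
  obtain ⟨h1, h2⟩ := h
  obtain ⟨h1', h2'⟩ := h'
  simp only [hM, hM', of_apply, cons_val', cons_val_zero, cons_val_one, cons_val_fin_one]
    at h1 h2 h1' h2'
  -- The inverses may be replaced by exact polynomials p + tq − qA and p' + tq' − q'A, because the
  -- factor before them lies in the kernel.
  rw [e1, mul_eq_mul_of_map_eq hφ (C := !![p + t * q, d * q; -q, p] *
    !![p' + t * q', d * q'; -q', p']) e0]
  · obtain ⟨b, rfl⟩ : ∃ b, r = -(d * q) + b := ⟨r + d * q, by ring⟩
    obtain ⟨e, rfl⟩ : ∃ e, s = p + t * q + e := ⟨s - p - t * q, by ring⟩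
    obtain ⟨b', rfl⟩ : ∃ b', r' = -(d * q') + b' := ⟨r' + d * q', by ring⟩
    obtain ⟨e', rfl⟩ : ∃ e', s' = p' + t * q' + e' := ⟨s' - p' - t * q', by ring⟩
    have hb : φ b = 0 := by simpa using h1
    have he : φ e = 0 := by simpa using h2
    have hb' : φ b' = 0 := by simpa using h1'
    have he' : φ e' = 0 := by simpa using h2'
    have z1 := hφ.mul_eq_zero hb he'
    have z2 := hφ.mul_eq_zero hb' he
    rw [hM, hM', companionTwo]
    simp only [mul_fin_two, trace_fin_two_of, of_sub_of, sub_cons, head_cons, tail_cons,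
      sub_self, zero_empty]
    linear_combination (p * p' - d * q * q') * (z1 - z2)
  · rw [toMat_inv hM, toMat_inv hM', Matrix.map_mul, Matrix.map_mul]
    congr 1
    · ext i j
      fin_cases i <;> fin_cases j <;> simp [h1, h2]
    · ext i j
      fin_cases i <;> fin_cases j <;> simp [h1', h2']

end SpecialLinear

/-! ### The companion matrix case. -/

section SpecialLinear

open Matrix

variable {R R' : Type*} [CommRing R] [CommRing R'] {φ : R →+* R'} {ψ : AddChar R ℂˣ} {t d : R}

theorem exists_toMat_eq_one_add (hφ : IsPrimitiveOver φ ψ) {X : Matrix (Fin 2) (Fin 2) R}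
    (hX : X.map φ = 0) (htr : trace X = 0) :
    ∃ M : SpecialLinearGroup (Fin 2) R, toMat M = 1 + X := by
  refine ⟨⟨1 + X, ?_⟩, rfl⟩
  have hX' : ∀ i j, φ (X i j) = 0 := fun i j => congrFun (congrFun hX i) j
  rw [trace_fin_two] at htr
  simp only [det_fin_two, Matrix.add_apply, one_apply_eq, one_apply_ne zero_ne_one,
    one_apply_ne one_ne_zero]
  linear_combination htr + hφ.mul_eq_zero (hX' 0 0) (hX' 1 1) - hφ.mul_eq_zero (hX' 0 1) (hX' 1 0)

variable {S : Type*} [Group S] {K : Subgroup S} [K.Normal] {χ : K →* ℂˣ}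
  (c : S ≃* SpecialLinearGroup (Fin 2) R)

theorem apply_conj_of_mem_inertiaGroup (hφ : IsPrimitiveOver φ ψ)
    (hK : ∀ g, g ∈ K ↔ SpecialLinearGroup.map φ (c g) = 1)
    (hχ : ∀ k : K, χ k = ψ (trace (companionTwo t d * (toMat (c k) - 1))))
    {g : S} (hg : g ∈ inertiaGroup χ) {X : Matrix (Fin 2) (Fin 2) R}
    (hX : X.map φ = 0) (htr : trace X = 0) :
    ψ (trace (companionTwo t d * (toMat (c g) * X * toMat (c g)⁻¹))) =
      ψ (trace (companionTwo t d * X)) := by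
  obtain ⟨M, hM⟩ := exists_toMat_eq_one_add hφ hX htr
  have hk : c.symm M ∈ K := by
    rw [hK, MulEquiv.apply_symm_apply]
    refine toMat_injective ?_
    rw [toMat_map, hM, Matrix.map_add _ (map_add φ), hX, add_zero, toMat_one,
      Matrix.map_one _ (map_zero φ) (map_one φ)]
  have h1 := hg ⟨_, hk⟩
  rw [hχ, hχ, MulAut.conjNormal_apply, map_mul, map_mul, map_inv, MulEquiv.apply_symm_apply,
    toMat_mul, toMat_mul, hM, mul_add, add_mul, mul_one, ← toMat_mul, mul_inv_cancel, toMat_one,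
    add_sub_cancel_left, add_sub_cancel_left] at h1
  exact h1

/-- The Clifford theory of a character of the congruence subgroup of the special linear group that
is given by a companion matrix. -/
theorem existsUnique_isCliffordSubgroup_of_companionTwo [Finite S] (hφ : IsPrimitiveOver φ ψ)
    (hK : ∀ g, g ∈ K ↔ SpecialLinearGroup.map φ (c g) = 1)
    (hχ : ∀ k : K, χ k = ψ (trace (companionTwo t d * (toMat (c k) - 1))))
    {C : Subgroup S} (hCχ : C ≤ inertiaGroup χ)
    (hC : ∀ g, g ∈ C ↔ CentralizesCompanion φ t d (c g)) :
    (∃! M : Subgroup (inertiaGroup χ), IsCliffordSubgroup C χ M) ∧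
      ∀ (M : Subgroup (inertiaGroup χ)) [M.Normal],
        IsCliffordSubgroup C χ M → InductionBijective χ M := by
  set N := C.subgroupOf (inertiaGroup χ) with hNdef
  have hNmem : ∀ g : inertiaGroup χ, g ∈ N ↔ CentralizesCompanion φ t d (c g) := fun g => hC g
  have hKN : ∀ g : inertiaGroup χ, (g : S) ∈ K → g ∈ N := by
    intro g hg
    rw [hK] at hg
    have h1 : ∀ i j, φ (toMat (c g) i j) = (1 : Matrix (Fin 2) (Fin 2) R') i j := fun i j =>
      congrFun (congrFun (congrArg toMat hg) i) j
    rw [hNmem, CentralizesCompanion, h1, h1, h1, h1]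
    simp
  let E : Set (inertiaGroup χ) :=
    {e | ∃ x, φ (2 * x) = 0 ∧ φ (x ^ 2 + t * x) = 0 ∧ c e = upperSL x}
  have hmul : ∀ g : inertiaGroup χ, ∃ n ∈ N, ∃ e ∈ E, g = n * e := by
    intro g
    obtain ⟨x, hx, hx', hgx⟩ := exists_centralizesCompanion_mul hφ
      (fun X hX htr => apply_conj_of_mem_inertiaGroup c hφ hK hχ g.2 hX htr)
    have hn : (g : S) * (c.symm (upperSL x))⁻¹ ∈ C := by
      rw [hC, map_mul, map_inv, MulEquiv.apply_symm_apply]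
      exact hgx
    have hn' : (⟨_, hCχ hn⟩ : inertiaGroup χ) ∈ N := hn
    refine ⟨_, hn', (⟨_, hCχ hn⟩ : inertiaGroup χ)⁻¹ * g, ⟨x, hx, hx', ?_⟩, by group⟩
    rw [← MulEquiv.eq_symm_apply]
    simp
  have hNnormal : N.Normal := by
    refine ⟨fun n hn g => ?_⟩
    obtain ⟨n', hn', e, ⟨x, hx, hx', he⟩, rfl⟩ := hmul g
    have h1 : e * n * e⁻¹ ∈ N := by
      rw [hNmem]
      push_cast
      rw [map_mul, map_mul, map_inv, he]
      exact ((hNmem n).1 hn).conj_upperSL hx hx'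
    have h2 : n' * e * n * (n' * e)⁻¹ = n' * (e * n * e⁻¹) * n'⁻¹ := by group
    rw [h2]
    exact N.mul_mem (N.mul_mem hn' h1) (N.inv_mem hn')
  have hN : IsAbelianOver χ N := by
    refine ⟨hKN, fun a ha b hb => ?_⟩
    rw [hNmem] at ha hb
    have h1 : ((a * b * a⁻¹ * b⁻¹ : inertiaGroup χ) : S) ∈ K := by
      rw [hK]
      push_cast
      simp only [map_mul, map_inv]
      rw [(ha.commute hb).eq, mul_inv_cancel_right, mul_inv_cancel]
    refine ⟨h1, ?_⟩
    rw [hχ]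
    push_cast
    simp only [map_mul, map_inv]
    rw [ha.trace_commutator hφ hb, AddChar.map_zero_eq_one]
  have hEk : ∀ {e : inertiaGroup χ} {x}, c e = upperSL x → φ x = 0 → (e : S) ∈ K := by
    intro e x he hx
    rw [hK, he, map_upperSL_eq_one hx]
  have hE : IsTransversalOver χ N E := by
    refine ⟨hmul, ?_, ?_⟩
    · rintro e ⟨x, -, -, he⟩ e' ⟨y, -, -, he'⟩
      refine Subtype.ext (c.injective ?_)
      push_cast
      rw [map_mul, map_mul, he, he', ← upperSL_add, ← upperSL_add, add_comm]
    · rintro e ⟨x, hx, -, he⟩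
      refine hEk (x := 2 * x) ?_ hx
      push_cast
      rw [map_mul, he, ← upperSL_add, two_mul]
  have hcomm : ∀ {e n : inertiaGroup χ} {x}, c e = upperSL x → n ∈ N →
      φ (x * toMat (c n) 1 0) = 0 → ((e * n * e⁻¹ * n⁻¹ : inertiaGroup χ) : S) ∈ K := by
    intro e n x he hn hx
    rw [hK]
    push_cast
    rw [map_mul c, map_mul c, map_mul c, map_inv c, map_inv c, he]
    exact map_commutator_upperSL ((hNmem n).1 hn) hx
  have htriv : ∀ {e : inertiaGroup χ} {x}, c e = upperSL x → IsTrivialOnCommutators χ N e →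
      IsTrivialOnNormOne φ ψ t d x := by
    rintro e x he htriv p q ⟨p, rfl⟩ hpq hxq
    set ν := (p : R) ^ 2 + t * p * q + d * q ^ 2 with hν
    -- p + qA has determinant 1 only modulo the kernel. Adding δ to its last entry corrects this,
    -- which is why p is required to be a unit.
    set δ := (1 - ν) * (p⁻¹ : Rˣ) with hδ
    have hpδ : p * δ = 1 - ν := by
      rw [hδ, mul_comm (1 - ν), Units.mul_inv_cancel_left]
    have hdet : (p : R) * (p + t * q + δ) - (-(d * q)) * q = 1 := by
      linear_combination hpδ + hν
    let M : SpecialLinearGroup (Fin 2) R :=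
      ⟨!![(p : R), -(d * q); q, p + t * q + δ], by rw [det_fin_two_of, hdet]⟩
    have hM : toMat M = !![(p : R), -(d * q); q, p + t * q + δ] := rfl
    have hδ0 : φ δ = 0 := by
      rw [hδ, map_mul, map_sub, map_one, hpq, sub_self, zero_mul]
    have hMN : c.symm M ∈ C := by
      rw [hC, MulEquiv.apply_symm_apply, CentralizesCompanion, hM]
      simp [hδ0]
    let n : inertiaGroup χ := ⟨_, hCχ hMN⟩
    have hnN : n ∈ N := hMN
    have hcn : c n = M := MulEquiv.apply_symm_apply _ _
    have hk := hcomm he hnN (by rw [hcn, hM]; exact hxq)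
    have h1 := htriv n hnN hk
    rw [hχ] at h1
    push_cast at h1
    rw [map_mul, map_mul, map_mul, map_inv, map_inv, he, hcn, trace_commutator_upperSL hM hdet]
      at h1
    rw [← h1]
    congr 1
    linear_combination (-x) * hpδ
  refine hE.existsUnique_isCliffordSubgroup hCχ rfl hN ?_
  -- Failure of n ≡ p + qA to commute with u_x modulo K gives qx ≢ 0, and u_y outside N gives y ≢ 0.
  -- So x ≡ y, and the two representatives differ by an element of K.
  rintro e ⟨x, -, -, he⟩ e' ⟨y, hy2, -, he'⟩ htx hty heN ⟨n, hn, hk⟩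
  have hqx : φ (x * toMat (c n) 1 0) ≠ 0 := fun h => hk (hcomm he hn h)
  have hy0 : φ y ≠ 0 := fun h => heN (hKN _ (hEk he' h))
  have hx0 : φ x ≠ 0 := fun h => hqx (by rw [map_mul, h, zero_mul])
  rw [hNmem] at hn
  obtain ⟨p, r, q, s, hM, hdet⟩ := exists_toMat_eq (c n)
  obtain ⟨h1, h2⟩ := hn
  simp only [hM, of_apply, cons_val', cons_val_zero, cons_val_one, cons_val_fin_one]
    at h1 h2 hqx
  have hpq : φ (p ^ 2 + t * p * q + d * q ^ 2) = 1 := by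
    have := congrArg φ hdet
    simp only [map_sub, map_mul, map_one, h1, h2, map_add, map_pow] at this ⊢
    linear_combination this
  have hz := IsTrivialOnNormOne.sub_eq_zero hφ (htriv he htx) (htriv he' hty) hx0 hy0 hy2 hpq
    (by rwa [mul_comm])
  refine hKN _ (hEk (x := -(x - y)) ?_ (by rw [map_neg, hz, neg_zero]))
  push_cast
  rw [map_mul, map_inv, he, he', ← upperSL_neg, ← upperSL_add]
  congr 1
  ring

end SpecialLinear

/-! ### Reduction of a cyclic matrix to its companion matrix. -/

section SpecialLinear

open Matrix

variable {R R' : Type*} [CommRing R] [CommRing R'] {φ : R →+* R'} {ψ : AddChar R ℂˣ} {t d : R}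

/-- Conjugation of the special linear group by an invertible matrix. -/
def conjSL (h : (Matrix (Fin 2) (Fin 2) R)ˣ) :
    SpecialLinearGroup (Fin 2) R ≃* SpecialLinearGroup (Fin 2) R where
  toFun g := ⟨(h⁻¹).1 * toMat g * h.1, by rw [det_units_conj']; exact g.2⟩
  invFun g := ⟨h.1 * toMat g * (h⁻¹).1, by rw [det_units_conj]; exact g.2⟩
  left_inv g := by
    refine toMat_injective ?_
    change h.1 * ((h⁻¹).1 * toMat g * h.1) * (h⁻¹).1 = toMat g
    simp [mul_assoc]
  right_inv g := by
    refine toMat_injective ?_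
    change (h⁻¹).1 * (h.1 * toMat g * (h⁻¹).1) * h.1 = toMat g
    simp [mul_assoc]
  map_mul' g g' := by
    refine toMat_injective ?_
    change (h⁻¹).1 * toMat (g * g') * h.1 = (h⁻¹).1 * toMat g * h.1 * ((h⁻¹).1 * toMat g' * h.1)
    simp [mul_assoc, toMat_mul]

theorem toMat_conjSL (h : (Matrix (Fin 2) (Fin 2) R)ˣ) (g : SpecialLinearGroup (Fin 2) R) :
    toMat (conjSL h g) = (h⁻¹).1 * toMat g * h.1 := rfl

theorem map_conjSL (h : (Matrix (Fin 2) (Fin 2) R)ˣ) (g : SpecialLinearGroup (Fin 2) R) :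
    SpecialLinearGroup.map φ (conjSL h g) =
      conjSL (h.map φ.mapMatrix.toMonoidHom) (SpecialLinearGroup.map φ g) := by
  refine toMat_injective ?_
  rw [toMat_conjSL, toMat_map, toMat_conjSL, Matrix.map_mul, Matrix.map_mul]
  rfl

/-- An element whose image under a homomorphism with square-zero kernel is a unit is a unit. -/
theorem IsPrimitiveOver.isUnit_of_map (hφ : IsPrimitiveOver φ ψ)
    (hsurj : Function.Surjective φ) {a : R} (ha : IsUnit (φ a)) : IsUnit a := by
  obtain ⟨b', hb⟩ := isUnit_iff_exists_inv.1 ha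
  obtain ⟨b, rfl⟩ := hsurj b'
  have hk : φ (a * b - 1) = 0 := by rw [map_sub, map_mul, hb, map_one, sub_self]
  -- One Newton step: the error 1 − ab is replaced by its square, which is zero.
  refine isUnit_iff_exists_inv.2 ⟨b * (2 - a * b), ?_⟩
  linear_combination (-1 : R) * hφ.mul_eq_zero hk hk

/-- A cyclic matrix is similar to the companion matrix of its characteristic polynomial. -/
theorem IsCyclicMatrix.exists_mul_eq {A : Matrix (Fin 2) (Fin 2) R} (hA : IsCyclicMatrix A) :
    ∃ P : Matrix (Fin 2) (Fin 2) R, IsUnit P.det ∧ A * P = P * companionTwo A.trace A.det := by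
  obtain ⟨v, hv⟩ := hA
  -- The columns are v and Av; the intertwining relation is Cayley–Hamilton applied to v.
  refine ⟨!![v 0, A.mulVec v 0; v 1, A.mulVec v 1], ?_, ?_⟩
  · rw [← isUnit_iff_isUnit_det, ← mulVec_surjective_iff_isUnit]
    intro w
    obtain ⟨a, b, h⟩ := Submodule.mem_span_pair.1 (hv ▸ Submodule.mem_top : w ∈ _)
    refine ⟨![a, b], ?_⟩
    rw [← h]
    ext i
    fin_cases i <;> simp [mulVec, dotProduct, Fin.sum_univ_two] <;> ring
  · obtain ⟨p, r, q, s, rfl⟩ : ∃ p r q s, A = !![p, r; q, s] := ⟨_, _, _, _, eta_fin_two _⟩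
    ext i j
    fin_cases i <;> fin_cases j <;>
      simp [companionTwo, mulVec, dotProduct, Fin.sum_univ_two, trace_fin_two, det_fin_two,
        mul_apply] <;> ring

/-- The matrix h conjugates A to the companion matrix only modulo the kernel. That is enough, since
Y has entries in the kernel and products of two such elements vanish. -/
theorem trace_companionTwo_conjSL (hφ : IsPrimitiveOver φ ψ) {A : Matrix (Fin 2) (Fin 2) R}
    {h : (Matrix (Fin 2) (Fin 2) R)ˣ} (hA : (A * h.1).map φ = (h.1 * companionTwo t d).map φ)
    {Y : Matrix (Fin 2) (Fin 2) R} (hY : Y.map φ = 0) :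
    trace (companionTwo t d * ((h⁻¹).1 * Y * h.1)) = trace (A * Y) := by
  have h1 : Y * A = Y * (h.1 * companionTwo t d * (h⁻¹).1) := by
    refine mul_eq_mul_of_map_eq hφ hY ?_
    rw [Matrix.map_mul, ← hA, ← Matrix.map_mul, mul_assoc, Units.mul_inv, mul_one]
  rw [trace_mul_comm A, h1, mul_assoc h.1, ← mul_assoc Y, trace_mul_comm (Y * h.1)]
  simp only [mul_assoc]

end SpecialLinear

/-! ### Stabilizers over the truncated rings, and the theorem. -/

section Main

open Matrix

variable {𝒪 : Type*} [CommRing 𝒪] [IsLocalRing 𝒪] {ℓ : ℕ}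

theorem map_liftMatrix (A : Matrix (Fin 2) (Fin 2) (TruncRing 𝒪 ℓ)) :
    (liftMatrix A).map (truncMap 𝒪 ℓ) = A := by
  ext i j
  exact Function.surjInv_eq (truncMap_surjective ℓ) _

theorem mem_congSL_iff (g : SpecialLinearGroup (Fin 2) (TruncRing 𝒪 (2 * ℓ))) :
    g ∈ congSL 𝒪 ℓ ↔ SpecialLinearGroup.map (truncMap 𝒪 ℓ) g = 1 := by
  rw [Subgroup.mem_comap, MonoidHom.mem_ker]
  constructor
  · intro h
    refine toMat_injective ?_
    exact congrArg Units.val h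
  · intro h
    refine Units.ext ?_
    exact congrArg toMat h

theorem stabSL_le_inertiaGroup (ψ : AddChar (TruncRing 𝒪 (2 * ℓ)) ℂˣ)
    (A : Matrix (Fin 2) (Fin 2) (TruncRing 𝒪 ℓ)) :
    stabSL ψ A ≤ inertiaGroup (psiBracket ψ A) := by
  intro g hg n
  refine Eq.trans ?_ (hg (SpecialLinearGroup.toGL.subgroupComap (congGL 𝒪 ℓ) n))
  refine congrArg (psiA ψ A) (Subtype.ext ?_)
  change SpecialLinearGroup.toGL (g * n.1 * g⁻¹) = _
  rw [map_mul, map_mul, map_inv]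
  rfl

theorem mem_stabSL_iff (ψ : AddChar (TruncRing 𝒪 (2 * ℓ)) ℂˣ)
    (A : Matrix (Fin 2) (Fin 2) (TruncRing 𝒪 ℓ))
    (g : SpecialLinearGroup (Fin 2) (TruncRing 𝒪 (2 * ℓ))) :
    g ∈ stabSL ψ A ↔ ∀ Y : Matrix (Fin 2) (Fin 2) (TruncRing 𝒪 (2 * ℓ)),
      Y.map (truncMap 𝒪 ℓ) = 0 →
        ψ (trace (liftMatrix A * (toMat g * Y * toMat g⁻¹))) = ψ (trace (liftMatrix A * Y)) := by
  have key : ∀ k : congGL 𝒪 ℓ, (psiA ψ A (MulAut.conjNormal (SpecialLinearGroup.toGL g) k) =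
      psiA ψ A k) ↔ ψ (trace (liftMatrix A * (toMat g * (k.1.1 - 1) * toMat g⁻¹))) =
        ψ (trace (liftMatrix A * (k.1.1 - 1))) := by
    intro k
    have h1 : (MulAut.conjNormal (SpecialLinearGroup.toGL g) k).1.1 - 1 =
        toMat g * (k.1.1 - 1) * toMat g⁻¹ := by
      rw [mul_sub, sub_mul, mul_one, ← toMat_mul, mul_inv_cancel, toMat_one]
      rfl
    rw [← h1]
    rfl
  constructor
  · intro hg Y hY
    have hYY : Y * Y = 0 := by
      ext i j
      rw [mul_apply]
      exact Finset.sum_eq_zero fun k _ => mul_eq_zero_of_truncMap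
        (congrFun (congrFun hY i) k) (congrFun (congrFun hY k) j)
    -- As Y² = 0, the matrix 1 + Y is invertible with inverse 1 − Y; every Y in the kernel thus
    -- comes from the congruence subgroup.
    let u : GL (Fin 2) (TruncRing 𝒪 (2 * ℓ)) :=
      ⟨1 + Y, 1 - Y, by rw [mul_sub, add_mul, add_mul, hYY]; simp,
        by rw [sub_mul, mul_add, mul_add, hYY]; simp⟩
    have hu : u ∈ congGL 𝒪 ℓ := by
      rw [MonoidHom.mem_ker]
      refine Units.ext ?_
      change (1 + Y).map (truncMap 𝒪 ℓ) = 1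
      rw [Matrix.map_add _ (map_add _), hY, add_zero, Matrix.map_one _ (map_zero _) (map_one _)]
    have := (key ⟨u, hu⟩).1 (hg _)
    change ψ (trace (liftMatrix A * (toMat g * ((1 + Y) - 1) * toMat g⁻¹))) =
      ψ (trace (liftMatrix A * ((1 + Y) - 1))) at this
    rwa [add_sub_cancel_left] at this
  · intro hg k
    refine (key k).2 (hg _ ?_)
    ext i j
    exact congGL_sub_one k i j

end Main

end

theorem mainTheorem4 {𝒪 : Type*} [CommRing 𝒪] [IsDomain 𝒪] [IsDiscreteValuationRing 𝒪]
    [IsAdicComplete (IsLocalRing.maximalIdeal 𝒪) 𝒪]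
    [Finite (IsLocalRing.ResidueField 𝒪)] [CharP (IsLocalRing.ResidueField 𝒪) 2]
    (ℓ : ℕ) (hℓ : boundR 𝒪 ≤ 2 * ℓ)
    (ϖ : 𝒪) (hϖ : Irreducible ϖ)
    (ψ : AddChar (TruncRing 𝒪 (2 * ℓ)) ℂˣ)
    (hψ : ψ (Ideal.Quotient.mk _ (ϖ ^ (2 * ℓ - 1))) ≠ 1)
    (A : Matrix (Fin 2) (Fin 2) (TruncRing 𝒪 ℓ)) (hA : IsCyclicMatrix A) :
    (∃! M : Subgroup (inertiaGroup (psiBracket ψ A)),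
      IsCliffordSubgroup (stabSL ψ A) (psiBracket ψ A) M) ∧
    ∀ (M : Subgroup (inertiaGroup (psiBracket ψ A))) [M.Normal],
      IsCliffordSubgroup (stabSL ψ A) (psiBracket ψ A) M →
        InductionBijective (psiBracket ψ A) M := by
  have hφ := isPrimitiveOver_truncMap hϖ ψ hψ
  have : Finite (𝒪 ⧸ maximalIdeal 𝒪) := ‹Finite (IsLocalRing.ResidueField 𝒪)›
  have : Finite (TruncRing 𝒪 (2 * ℓ)) :=
    Ideal.finite_quotient_pow (IsNoetherian.noetherian (maximalIdeal 𝒪)) _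
  obtain ⟨P, hP, hAP⟩ := hA.exists_mul_eq
  -- Any lift of P is invertible, so conjugation by it acts on the special linear group over 𝔬_{2ℓ}
  -- and brings A to companion form modulo ℘^ℓ.
  have hdet : IsUnit (liftMatrix P).det := by
    refine hφ.isUnit_of_map (truncMap_surjective ℓ) ?_
    rw [RingHom.map_det]
    change IsUnit ((liftMatrix P).map (truncMap 𝒪 ℓ)).det
    rwa [map_liftMatrix]
  obtain ⟨h, hh⟩ := (Matrix.isUnit_iff_isUnit_det _).2 hdet
  have htr : truncMap 𝒪 ℓ (liftMatrix A).trace = A.trace := by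
    conv_rhs => rw [← map_liftMatrix A]
    simp [Matrix.trace_fin_two]
  have hde : truncMap 𝒪 ℓ (liftMatrix A).det = A.det := by
    conv_rhs => rw [← map_liftMatrix A]
    exact RingHom.map_det _ _
  have hAh : (liftMatrix A * h.1).map (truncMap 𝒪 ℓ) =
      (h.1 * companionTwo (liftMatrix A).trace (liftMatrix A).det).map (truncMap 𝒪 ℓ) := by
    have h1 : (companionTwo (liftMatrix A).trace (liftMatrix A).det).map (truncMap 𝒪 ℓ) =
        companionTwo A.trace A.det := by
      rw [← htr, ← hde]
      ext i j
      fin_cases i <;> fin_cases j <;> simp [companionTwo]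
    rw [hh, Matrix.map_mul, Matrix.map_mul, map_liftMatrix, map_liftMatrix, h1, hAP]
  have hK : ∀ g, g ∈ congSL 𝒪 ℓ ↔
      Matrix.SpecialLinearGroup.map (truncMap 𝒪 ℓ) (conjSL h g) = 1 := by
    intro g
    rw [mem_congSL_iff, map_conjSL, MulEquiv.map_eq_one_iff]
  refine existsUnique_isCliffordSubgroup_of_companionTwo (t := (liftMatrix A).trace)
    (d := (liftMatrix A).det) (conjSL h) hφ hK (fun k => ?_)
    (stabSL_le_inertiaGroup ψ A) fun g => ?_
  · have h1 : toMat (conjSL h k) - 1 = (h⁻¹).1 * (toMat k.1 - 1) * h.1 := by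
      rw [toMat_conjSL, mul_sub, sub_mul, mul_one, Units.inv_mul]
    rw [h1, trace_companionTwo_conjSL hφ hAh]
    · rfl
    · ext i j
      exact congGL_sub_one (Matrix.SpecialLinearGroup.toGL.subgroupComap (congGL 𝒪 ℓ) k) i j
  · rw [centralizesCompanion_iff hφ, mem_stabSL_iff]
    have hconj : ∀ {X Z : Matrix (Fin 2) (Fin 2) (TruncRing 𝒪 (2 * ℓ))},
        X.map (truncMap 𝒪 ℓ) = 0 → (Z * X).map (truncMap 𝒪 ℓ) = 0 ∧
          (X * Z).map (truncMap 𝒪 ℓ) = 0 := by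
      intro X Z hX
      rw [Matrix.map_mul, Matrix.map_mul, hX, mul_zero, zero_mul]
      exact ⟨rfl, rfl⟩
    have hcg : ∀ Y, toMat (conjSL h g) * ((h⁻¹).1 * Y * h.1) * toMat (conjSL h g)⁻¹ =
        (h⁻¹).1 * (toMat g * Y * toMat g⁻¹) * h.1 := by
      intro Y
      rw [← map_inv, toMat_conjSL, toMat_conjSL]
      simp only [mul_assoc, Units.mul_inv_cancel_left]
    constructor
    · intro hg X hX
      have hY := (hconj (Z := (h⁻¹).1) (hconj (Z := h.1) hX).1).2
      have hXY : X = (h⁻¹).1 * (h.1 * X * (h⁻¹).1) * h.1 := by simp [mul_assoc]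
      rw [hXY, hcg, trace_companionTwo_conjSL hφ hAh hY, trace_companionTwo_conjSL hφ hAh, hg _ hY]
      exact (hconj (hconj hY).1).2
    · intro hg Y hY
      have h1 := hg ((h⁻¹).1 * Y * h.1) (hconj (hconj hY).1).2
      rwa [hcg, trace_companionTwo_conjSL hφ hAh hY, trace_companionTwo_conjSL hφ hAh] at h1
      exact (hconj (hconj hY).1).2
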